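/- Let $n,d\ge 1$ and $m\ge 0$ be integers with $d\le 2^n$. An $n$-qubit $d$-sparse state is a state $\sum_{i=0}^{d-1}\alpha_i|q_i\rangle$ given by pairwise distinct strings $q_0,\dots,q_{d-1}\in\{0,1\}^n$ and amplitudes $\alpha_i\in\mathbb{C}$ with $\sum_i|\alpha_i|^2=1$. A quantum circuit is a finite sequence of elementary gates, each of which is an arbitrary single-qubit unitary or a CNOT; its size is the number of gates. A circuit on $n+m$ qubits prepares the state with $m$ ancillary qubits if the unitary $U$ that it implements satisfies $U|0\rangle^{\otimes n}|0\rangle^{\otimes m}=\sum_{i=0}^{d-1}\alpha_i|q_i\rangle|0\rangle^{\otimes m}$. Theorem. For every constant $c$ there is a constant $C>0$, depending only on $c$, such that for all integers $n,d\ge1$ with $d\le 2^n$ and all integers $m\ge 0$ with $$m\le c\left(\frac{nd}{\log_2(nd)}+n\right),$$ every $n$-qubit $d$-sparse state can be prepared with $m$ ancillary qubits by a quantum circuit of size at most $$C\left(\frac{nd}{\log_2(m+n)}+n\right).$$ (A fraction whose denominator is $\log_2 1=0$ is read as $0$; this concerns only $nd=1$, respectively $m+n=1$.) -/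

import Mathlib

open scoped Matrix

namespace QCircuit

/-- Computational basis labels of an `N`-qubit register: bit strings of length `N`. -/
abbrev Bits (N : ℕ) : Type := Fin N → Fin 2

/-- The computational basis vector `|x⟩` of an `N`-qubit register. -/
def ket {N : ℕ} (x : Bits N) : Bits N → ℂ := Pi.single x 1

/-- Elementary gates on `N` qubits: an arbitrary single-qubit unitary applied to a qubit, or a
CNOT with distinct control and target qubits. -/
inductive Gate (N : ℕ) : Type
  | single (k : Fin N) (U : Matrix.unitaryGroup (Fin 2) ℂ) : Gate N
  | cnot (c t : Fin N) (h : c ≠ t) : Gate N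

/-- The `2 ^ N × 2 ^ N` matrix of a gate; entry `(x, y)` is `⟨x| g |y⟩`.
A single-qubit gate acts as `U` on qubit `k` and as the identity on the others; a CNOT sends `|y⟩`
to the basis vector in which `y t` is replaced by `y t + y c` (mod 2). -/
def Gate.toMatrix {N : ℕ} : Gate N → Matrix (Bits N) (Bits N) ℂ
  | .single k U => fun x y =>
      if ∀ j, j ≠ k → x j = y j then (U : Matrix (Fin 2) (Fin 2) ℂ) (x k) (y k) else 0
  | .cnot c t _ => fun x y => if x = Function.update y t (y t + y c) then 1 else 0

/-- A circuit is a finite sequence of elementary gates; the head of the list is applied first.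
Its size is the length of the list. -/
abbrev Circuit (N : ℕ) : Type := List (Gate N)

/-- The operator implemented by a circuit. -/
def Circuit.toMatrix {N : ℕ} : Circuit N → Matrix (Bits N) (Bits N) ℂ
  | [] => 1
  | g :: gs => Circuit.toMatrix gs * g.toMatrix

/-- The total number of elementary gates of a circuit. -/
def Circuit.size {N : ℕ} (circ : Circuit N) : ℕ := circ.length

/-- A circuit on `n + m` qubits prepares the `n`-qubit state `∑ i, α i |q i⟩` with `m` ancillary
qubits (the last `m` ones): it maps `|0⟩^n |0⟩^m` to `∑ i, α i |q i⟩ |0⟩^m`. -/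
def Circuit.Prepares {n m d : ℕ} (circ : Circuit (n + m)) (α : Fin d → ℂ) (q : Fin d → Bits n) :
    Prop :=
  Circuit.toMatrix circ *ᵥ ket 0 = ∑ i, α i • ket (Fin.append (q i) (0 : Bits m))

end QCircuit

/-! Put L = log₂(m + n). A state supported on a coordinate subcube with about d points can be
prepared densely with O(d) gates (`exists_dense_preparation`), so the problem is to move basis
strings. In `BatchSwap.exists_preparation` the target strings are padded to B batches of s strings.
Equally many sources, disjoint from the targets, are chosen in a subcube of fewer than 4Bs points.
The amplitudes are prepared on the sources, and each batch of s disjoint transpositions carries its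
sources to its targets. These permutations use NOT, CNOT and Toffoli gates, each costing at most 17
elementary gates. It remains to exchange s pairs with O(ns/L) gates, where Bs is not much larger
than d.

If m ≤ n^4, then L is comparable to log n and no ancilla is needed (`batchSwap_of_pow_le`). For s a
small multiple of log n, the table of the 2s strings has at most √n distinct columns. CNOTs from one
representative of each column clear all other coordinates of these strings, so every exchange
involves few coordinates. The test that the cleared coordinates vanish costs O(n); a commutator-like
word makes a bounded number of such tests suffice for the whole batch (`Rev.quadSwap`).

If m > n^4, the strings are cut into blocks of b bits, with b a small multiple of log m, and each
block is one-hot encoded on ancillas (`batchSwap_lookup`). Comparing with a fixed string then takes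
O(n/b) gates, and so does recording the difference to be added; encoding and decoding are shared by
the batch. The bound m = O(nd) keeps s = O(d) and b = O(n), so that rounding costs only constant
factors. For n < 256 dense preparation has bounded cost. -/

namespace QCircuit

/-! ### Action of gates and circuits on basis vectors -/

theorem Circuit.toMatrix_append {N : ℕ} (c₁ c₂ : Circuit N) :
    Circuit.toMatrix (c₁ ++ c₂) = Circuit.toMatrix c₂ * Circuit.toMatrix c₁ := by
  induction c₁ with
  | nil => simp [Circuit.toMatrix]
  | cons g gs ih => simp [Circuit.toMatrix, ih, Matrix.mul_assoc]

theorem Circuit.append_mulVec {N : ℕ} (c₁ c₂ : Circuit N) (v : Bits N → ℂ) :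
    Circuit.toMatrix (c₁ ++ c₂) *ᵥ v = Circuit.toMatrix c₂ *ᵥ (Circuit.toMatrix c₁ *ᵥ v) := by
  rw [Circuit.toMatrix_append, Matrix.mulVec_mulVec]

theorem Circuit.singleton_mulVec {N : ℕ} (g : Gate N) (v : Bits N → ℂ) :
    Circuit.toMatrix [g] *ᵥ v = g.toMatrix *ᵥ v := by
  simp [Circuit.toMatrix]

theorem ket_apply {N : ℕ} (x z : Bits N) : ket x z = if z = x then 1 else 0 := by
  simp [ket, Pi.single_apply]

theorem bit_eq (b : Fin 2) : b = 0 ∨ b = 1 := by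
  fin_cases b <;> simp

theorem mulVec_ket {N : ℕ} (A : Matrix (Bits N) (Bits N) ℂ) (x z : Bits N) :
    (A *ᵥ ket x) z = A z x := by
  simp [ket]

theorem sum_smul_ket {N : ℕ} (v : Bits N → ℂ) : ∑ x, v x • ket x = v := by
  ext z
  simp [ket_apply]

theorem mulVec_eq_sum {N : ℕ} (A : Matrix (Bits N) (Bits N) ℂ) (v : Bits N → ℂ) :
    A *ᵥ v = ∑ x, v x • (A *ᵥ ket x) := by
  conv_lhs => rw [← sum_smul_ket v]
  rw [Matrix.mulVec_sum]
  simp only [Matrix.mulVec_smul]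

theorem single_mulVec_ket {N : ℕ} (k : Fin N) (U : Matrix.unitaryGroup (Fin 2) ℂ) (x : Bits N) :
    (Gate.single k U).toMatrix *ᵥ ket x =
      (U : Matrix (Fin 2) (Fin 2) ℂ) 0 (x k) • ket (Function.update x k 0) +
      (U : Matrix (Fin 2) (Fin 2) ℂ) 1 (x k) • ket (Function.update x k 1) := by
  ext z
  rw [mulVec_ket]
  simp only [Gate.toMatrix, Pi.add_apply, Pi.smul_apply, ket_apply, smul_eq_mul,
    Function.eq_update_iff]
  by_cases h : ∀ j, j ≠ k → z j = x j
  · rw [if_pos h]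
    rcases bit_eq (z k) with hz | hz
    · simp only [hz, true_and, if_pos h]; simp
    · simp only [hz, true_and, if_pos h]; simp
  · rw [if_neg h]
    have h' : ∀ b, ¬ (z k = b ∧ ∀ j, j ≠ k → z j = x j) := fun b hb => h hb.2
    rw [if_neg (h' 0), if_neg (h' 1)]
    simp

theorem cnot_mulVec_ket {N : ℕ} (c t : Fin N) (h : c ≠ t) (x : Bits N) :
    (Gate.cnot c t h).toMatrix *ᵥ ket x = ket (Function.update x t (x t + x c)) := by
  ext z
  rw [mulVec_ket, ket_apply]
  rfl

/-! ### Monomial circuits: multiplexed rotations and the Toffoli gate -/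

/-- `f` and `φ` describe a monomial matrix implemented by a circuit with at most `s` gates. -/
def Monomial {N : ℕ} (s : ℕ) (f : Bits N → Bits N) (φ : Bits N → ℂ) : Prop :=
  ∃ circ : Circuit N, circ.length ≤ s ∧ ∀ x, Circuit.toMatrix circ *ᵥ ket x = φ x • ket (f x)

namespace Monomial

variable {N : ℕ}

theorem mono {s s' : ℕ} {f : Bits N → Bits N} {φ : Bits N → ℂ} (h : Monomial s f φ)
    (hs : s ≤ s') : Monomial s' f φ := by
  obtain ⟨c, hc, h⟩ := h
  exact ⟨c, hc.trans hs, h⟩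

theorem refl : Monomial (N := N) 0 id 1 := ⟨[], le_rfl, fun x => by simp [Circuit.toMatrix]⟩

theorem comp {s s' : ℕ} {f g : Bits N → Bits N} {φ ψ : Bits N → ℂ} (hf : Monomial s f φ)
    (hg : Monomial s' g ψ) : Monomial (s + s') (g ∘ f) (fun x => φ x * ψ (f x)) := by
  obtain ⟨c, hc, h⟩ := hf
  obtain ⟨c', hc', h'⟩ := hg
  refine ⟨c ++ c', by simp; omega, fun x => ?_⟩
  rw [Circuit.append_mulVec, h, Matrix.mulVec_smul, h', smul_smul]
  rfl

theorem congr {s : ℕ} {f g : Bits N → Bits N} {φ ψ : Bits N → ℂ} (hf : Monomial s f φ)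
    (h : ∀ x, f x = g x) (h' : ∀ x, φ x = ψ x) : Monomial s g ψ := by
  rwa [← funext h, ← funext h']

theorem cnot (c t : Fin N) (h : c ≠ t) :
    Monomial 1 (fun x => Function.update x t (x t + x c)) 1 :=
  ⟨[Gate.cnot c t h], by simp, fun x => by
    rw [Circuit.singleton_mulVec, cnot_mulVec_ket]; simp⟩

end Monomial

/-- The diagonal single-qubit unitary with phases `θ 0`, `θ 1`. -/
noncomputable def diagGate (θ : Fin 2 → ℝ) : Matrix.unitaryGroup (Fin 2) ℂ :=
  ⟨Matrix.diagonal fun b => Complex.exp (θ b * Complex.I), by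
    rw [Matrix.mem_unitaryGroup_iff, Matrix.star_eq_conjTranspose, Matrix.diagonal_conjTranspose,
      Matrix.diagonal_mul_diagonal, ← Matrix.diagonal_one]
    congr 1
    ext b
    simp only [Pi.star_apply, RCLike.star_def, Complex.mul_conj, Complex.normSq_eq_norm_sq,
      Complex.norm_exp_ofReal_mul_I]
    simp⟩

/-- The Pauli `X` matrix. -/
def notGate : Matrix.unitaryGroup (Fin 2) ℂ :=
  ⟨!![0, 1; 1, 0], by
    rw [Matrix.mem_unitaryGroup_iff, Matrix.star_eq_conjTranspose]
    ext i j
    fin_cases i <;> fin_cases j <;> simp [Matrix.mul_apply, Fin.sum_univ_two]⟩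

/-- The Hadamard matrix. -/
noncomputable def hadamard : Matrix.unitaryGroup (Fin 2) ℂ :=
  ⟨!![(√2 : ℂ)⁻¹, (√2 : ℂ)⁻¹; (√2 : ℂ)⁻¹, -(√2 : ℂ)⁻¹], by
    have h : (√2 : ℂ)⁻¹ * (√2 : ℂ)⁻¹ = 1 / 2 := by
      rw [← mul_inv, ← Complex.ofReal_mul, Real.mul_self_sqrt (by norm_num)]; norm_num
    rw [Matrix.mem_unitaryGroup_iff, Matrix.star_eq_conjTranspose]
    ext i j
    fin_cases i <;> fin_cases j <;> simp [Matrix.mul_apply, Fin.sum_univ_two, h] <;> norm_num⟩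

/-- The sign `(-1) ^ b` of a bit. -/
def sgn (b : Fin 2) : ℝ := if b = 0 then 1 else -1

theorem sgn_zero : sgn 0 = 1 := by simp [sgn]

theorem sgn_one : sgn 1 = -1 := by simp [sgn]

theorem sgn_add (a b : Fin 2) : sgn (a + b) = sgn a * sgn b := by
  fin_cases a <;> fin_cases b <;> simp [sgn]

theorem Monomial.diag {N : ℕ} (k : Fin N) (θ : Fin 2 → ℝ) :
    Monomial 1 id (fun x : Bits N => Complex.exp (θ (x k) * Complex.I)) := by
  refine ⟨[Gate.single k (diagGate θ)], by simp, fun x => ?_⟩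
  rw [Circuit.singleton_mulVec, single_mulVec_ket]
  rcases bit_eq (x k) with h | h
  · have : Function.update x k 0 = x := by rw [← h]; simp
    simp [diagGate, h, this]
  · have : Function.update x k 1 = x := by rw [← h]; simp
    simp [diagGate, h, this]

theorem Monomial.not {N : ℕ} (k : Fin N) :
    Monomial 1 (fun x : Bits N => Function.update x k (x k + 1)) 1 := by
  refine ⟨[Gate.single k notGate], by simp, fun x => ?_⟩
  rw [Circuit.singleton_mulVec, single_mulVec_ket]
  rcases bit_eq (x k) with h | h <;> simp [notGate, h]

theorem hadamard_mulVec_ket {N : ℕ} (k : Fin N) (x : Bits N) :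
    (Gate.single k hadamard).toMatrix *ᵥ ket x =
      (√2 : ℂ)⁻¹ • (ket (Function.update x k 0) + (sgn (x k) : ℂ) • ket (Function.update x k 1)) := by
  rw [single_mulVec_ket]
  rcases bit_eq (x k) with h | h <;> simp [hadamard, sgn, h]

/-- The phase of a multiplexed `z`-rotation of qubit `t` by the angle `θ`. -/
noncomputable def muxPhase {N : ℕ} (t : Fin N) (θ : Bits N → ℝ) (x : Bits N) : ℂ :=
  Complex.exp (((sgn (x t) * θ x : ℝ) : ℂ) * Complex.I)

/-- `f` depends only on the coordinates in the list `ks`. -/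
def DependsOnList {N : ℕ} {β : Type*} (f : Bits N → β) (ks : List (Fin N)) : Prop :=
  ∀ x y, (∀ j ∈ ks, x j = y j) → f x = f y

/-- Recursion on the controls. For a control `c`, the half-sum of the two restrictions of `θ` is
applied plainly, and the half-difference between two CNOTs from `c`, which reverse the rotation
exactly when `x c = 1`. The count obeys a(k+1) = 2 a(k) + 2 with a(0) = 1. -/
theorem Monomial.mux {N : ℕ} (t : Fin N) (ks : List (Fin N)) (ht : t ∉ ks) (θ : Bits N → ℝ)
    (hθ : DependsOnList θ ks) : Monomial (3 * 2 ^ ks.length - 2) id (muxPhase t θ) := by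
  induction ks generalizing θ with
  | nil =>
    refine ((Monomial.diag t fun b => sgn b * θ 0).mono (by simp)).congr (fun _ => rfl) fun x => ?_
    rw [muxPhase, hθ x 0 (by simp)]
  | cons c cs ih =>
    rw [List.mem_cons, not_or] at ht
    have hd : ∀ ε : ℝ, DependsOnList
        (fun x => (θ (Function.update x c 0) + ε * θ (Function.update x c 1)) / 2) cs := by
      intro ε x y hxy
      have : ∀ b, θ (Function.update x c b) = θ (Function.update y c b) := by
        intro b
        refine hθ _ _ fun j hj => ?_
        by_cases hjc : j = c
        · subst hjc; simp
        · simp only [List.mem_cons, hjc, false_or] at hj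
          simp [hjc, hxy j hj]
      simp only [this]
    have hpos := Nat.one_le_two_pow (n := cs.length)
    refine ((((ih ht.2 _ (hd 1)).comp (Monomial.cnot c t (Ne.symm ht.1))).comp
      (ih ht.2 _ (hd (-1)))).comp (Monomial.cnot c t (Ne.symm ht.1))).mono (s' := _) ?_
        |>.congr ?_ ?_
    · rw [List.length_cons, pow_succ]; omega
    · intro x
      have hct : x c + x c = 0 := by rcases bit_eq (x c) with h | h <;> simp [h]
      simp only [Function.comp_apply, id_eq, Function.update_self,
        Function.update_of_ne (Ne.symm ht.1), add_assoc, hct, add_zero, Function.update_idem]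
      simp
    · intro x
      have hx : ∀ b, θ (Function.update (Function.update x t (x t + x c)) c b) =
          θ (Function.update x c b) := by
        intro b
        refine hθ _ _ fun j hj => ?_
        have : j ≠ t := by
          rintro rfl
          rcases List.mem_cons.mp hj with h | h
          · exact ht.1 h
          · exact ht.2 h
        by_cases hjc : j = c <;> simp [this, hjc]
      simp only [muxPhase, Function.comp_apply, id_eq, Function.update_self, Pi.one_apply, mul_one,
        hx, ← Complex.exp_add, sgn_add]
      congr 1
      rw [← add_mul, ← Complex.ofReal_add]
      congr 2
      rcases bit_eq (x c) with h | h
      · have : Function.update x c 0 = x := by rw [← h]; simp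
        rw [this, h]; simp only [sgn_zero]; ring
      · have : Function.update x c 1 = x := by rw [← h]; simp
        rw [this, h]; simp only [sgn_one]; ring

/-- Conjugating a conditional sign by Hadamard gates gives a conditional bit flip. -/
theorem Monomial.flip_of_sign {N : ℕ} {s : ℕ} (t : Fin N) (p : Bits N → Fin 2)
    (hp : ∀ x b, p (Function.update x t b) = p x)
    (h : Monomial s id (fun x => (sgn (x t * p x) : ℂ))) :
    Monomial (s + 2) (fun x => Function.update x t (x t + p x)) 1 := by
  obtain ⟨c, hc, h⟩ := h
  have h2 : (√2 : ℂ)⁻¹ * (√2 : ℂ)⁻¹ = 1 / 2 := by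
    rw [← mul_inv, ← Complex.ofReal_mul, Real.mul_self_sqrt (by norm_num)]; norm_num
  refine ⟨[Gate.single t hadamard] ++ c ++ [Gate.single t hadamard], by simp; omega, fun x => ?_⟩
  simp only [Circuit.append_mulVec, Circuit.singleton_mulVec, hadamard_mulVec_ket,
    Matrix.mulVec_smul, Matrix.mulVec_add, h, id, hp, Function.update_self, Function.update_idem,
    Pi.one_apply, one_smul]
  rcases bit_eq (x t) with h0 | h0 <;> rcases bit_eq (p x) with h1 | h1 <;>
    simp only [h0, h1, sgn] <;> ext z <;> simp
  · linear_combination (2 * ket (Function.update x t 0) z) * h2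
  · linear_combination (2 * ket (Function.update x t 1) z) * h2
  · linear_combination (2 * ket (Function.update x t 1) z) * h2
  · linear_combination (2 * ket (Function.update x t 0) z) * h2

theorem exp_ofReal_add {a b : ℝ} : Complex.exp ((a : ℂ) * Complex.I) *
    Complex.exp ((b : ℂ) * Complex.I) = Complex.exp (((a + b : ℝ) : ℂ) * Complex.I) := by
  rw [← Complex.exp_add, ← add_mul, Complex.ofReal_add]

/-- The sign is the phase π·abt = (π/4)·a·(1 - sgn b) - (π/2)·ab·sgn t. Its three terms take 1 + 4 +
10 gates, and the two Hadamard gates on `t` make 17. -/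
theorem Monomial.toffoli {N : ℕ} (a b t : Fin N) (ha : a ≠ t) (hb : b ≠ t) (hab : a ≠ b) :
    Monomial 17 (fun x : Bits N => Function.update x t (x t + x a * x b)) 1 := by
  refine Monomial.flip_of_sign t (fun x => x a * x b)
    (fun x c => by simp [Function.update_of_ne, ha, hb]) ?_
  refine (((Monomial.diag a fun i => if i = 0 then 0 else Real.pi / 4).comp
    (Monomial.mux b [a] (by simpa using Ne.symm hab)
      (fun x => if x a = 0 then 0 else -(Real.pi / 4)) fun x y h => ?_)).comp
    (Monomial.mux t [a, b] (by simp [Ne.symm ha, Ne.symm hb])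
      (fun x => if x a * x b = 0 then 0 else -(Real.pi / 2)) fun x y h => ?_)).mono
      (s' := 15) (by simp) |>.congr (fun _ => rfl) fun x => ?_
  · simp [h a (by simp)]
  · simp [h a (by simp), h b (by simp)]
  · simp only [muxPhase, exp_ofReal_add, id]
    have key : ∀ r : ℝ, ∀ q : Fin 2, (r = 0 ∧ q = 0 ∨ r = Real.pi ∧ q = 1) →
        Complex.exp ((r : ℂ) * Complex.I) = (sgn q : ℂ) := by
      rintro r q (⟨rfl, rfl⟩ | ⟨rfl, rfl⟩) <;> simp [sgn]
    apply key
    rcases bit_eq (x a) with h0 | h0 <;> rcases bit_eq (x b) with h1 | h1 <;>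
      rcases bit_eq (x t) with h2 | h2 <;> simp [h0, h1, h2, sgn] <;> ring_nf

/-! ### Dense state preparation -/

/-- Polar coordinates for a pair of complex numbers. -/
theorem exists_pair_polar (u v : ℂ) : ∃ (r : ℂ) (ω δ : ℝ),
    r * (Complex.cos ω * Complex.exp ((δ : ℂ) * Complex.I)) = u ∧
    r * (Complex.I * Complex.sin ω * Complex.exp (((-δ : ℝ) : ℂ) * Complex.I)) = v ∧
    ‖r‖ ^ 2 = ‖u‖ ^ 2 + ‖v‖ ^ 2 := by
  set v' : ℂ := -Complex.I * v with hv'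
  have hvv : v = Complex.I * v' := by
    rw [hv', ← mul_assoc, mul_neg, Complex.I_mul_I]; simp
  have hn : ‖v‖ = ‖v'‖ := by rw [hvv]; simp
  set w : ℂ := ⟨‖u‖, ‖v'‖⟩ with hw
  have hc : ‖w‖ * Real.cos w.arg = ‖u‖ := by rw [Complex.norm_mul_cos_arg]
  have hs : ‖w‖ * Real.sin w.arg = ‖v'‖ := by rw [Complex.norm_mul_sin_arg]
  -- With v = i·v', the polar form of |u| + i|v'| supplies |r| and ω; the half-sum of the arguments
  -- of u and v' goes into r, the half-difference into δ.
  refine ⟨‖w‖ * Complex.exp (((u.arg + v'.arg) / 2 : ℝ) * Complex.I), w.arg,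
    (u.arg - v'.arg) / 2, ?_, ?_, ?_⟩
  · calc _ = ((‖w‖ * Real.cos w.arg : ℝ) : ℂ) *
          (Complex.exp (((u.arg + v'.arg) / 2 : ℝ) * Complex.I) *
            Complex.exp (((u.arg - v'.arg) / 2 : ℝ) * Complex.I)) := by
          push_cast; ring
      _ = u := by
          rw [hc, exp_ofReal_add]
          conv_rhs => rw [← Complex.norm_mul_exp_arg_mul_I u]
          congr 4; ring
  · calc _ = Complex.I * (((‖w‖ * Real.sin w.arg : ℝ) : ℂ) *
          (Complex.exp (((u.arg + v'.arg) / 2 : ℝ) * Complex.I) *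
            Complex.exp ((-((u.arg - v'.arg) / 2) : ℝ) * Complex.I))) := by
          push_cast; ring
      _ = v := by
          rw [hs, exp_ofReal_add, hvv]
          conv_rhs => rw [← Complex.norm_mul_exp_arg_mul_I v']
          congr 5; ring
  · rw [norm_mul, Complex.norm_exp_ofReal_mul_I, mul_one, Complex.norm_real, norm_norm,
      ← Complex.normSq_eq_norm_sq, hn, hw, Complex.normSq_mk]
    ring

/-- A multiplexed rotation taking `|0⟩` on qubit `k` to an arbitrary direction. -/
theorem exists_mux_rotation {N : ℕ} (k : Fin N) (ks : List (Fin N)) (hk : k ∉ ks)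
    (ω δ : Bits N → ℝ) (hω : DependsOnList ω ks) (hδ : DependsOnList δ ks) :
    ∃ circ : Circuit N, circ.length ≤ 6 * 2 ^ ks.length - 2 ∧
      ∀ x, x k = 0 → Circuit.toMatrix circ *ᵥ ket x =
        (Complex.cos (ω x) * Complex.exp ((δ x : ℂ) * Complex.I)) • ket x +
        (Complex.I * Complex.sin (ω x) * Complex.exp (((-δ x : ℝ) : ℂ) * Complex.I)) •
          ket (Function.update x k 1) := by
  obtain ⟨c, hc, h⟩ := Monomial.mux k ks hk ω hω
  obtain ⟨c', hc', h'⟩ := Monomial.mux k ks hk δ hδ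
  have hpos := Nat.one_le_two_pow (n := ks.length)
  have h2 : (√2 : ℂ)⁻¹ * (√2 : ℂ)⁻¹ = 1 / 2 := by
    rw [← mul_inv, ← Complex.ofReal_mul, Real.mul_self_sqrt (by norm_num)]; norm_num
  -- Conjugation by Hadamard gates turns the z-rotation into an x-rotation with entries cos ω and i
  -- sin ω; the second multiplexer attaches the opposite phases ±δ.
  refine ⟨[Gate.single k hadamard] ++ c ++ [Gate.single k hadamard] ++ c',
    by simp; omega, fun x hx => ?_⟩
  have hd : ∀ (f : Bits N → ℝ), DependsOnList f ks → f (Function.update x k 1) = f x := by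
    intro f hf
    refine hf _ _ fun j hj => ?_
    rw [Function.update_of_ne]
    rintro rfl
    exact hk hj
  have hx0 : Function.update x k 0 = x := by rw [← hx]; simp
  simp only [Circuit.append_mulVec, Circuit.singleton_mulVec, hadamard_mulVec_ket,
    Matrix.mulVec_smul, Matrix.mulVec_add, h, h', id, muxPhase, Function.update_self, hd ω hω,
    hd δ hδ, Function.update_idem, hx0, hx, sgn_zero, sgn_one, one_mul, smul_add, smul_smul]
  rw [Complex.cos, Complex.sin]
  ext z
  simp only [Pi.add_apply, Pi.smul_apply, smul_eq_mul]
  push_cast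
  simp only [neg_mul, one_mul, mul_one, mul_neg]
  generalize ket x z = A
  generalize ket (Function.update x k 1) z = B
  generalize Complex.exp (ω x * Complex.I) = e
  generalize Complex.exp (-(ω x * Complex.I)) = e'
  generalize Complex.exp (δ x * Complex.I) = f
  generalize Complex.exp (-(δ x * Complex.I)) = f'
  linear_combination ((e + e') * f * A + (e - e') * f' * B) * h2 +
    (e - e') * f' * B / 2 * Complex.I_mul_I

/-- A state supported on the span of the qubits in `ks` can be prepared with `O(2 ^ |ks|)`
gates. -/
theorem exists_dense_preparation {N : ℕ} (k₀ : Fin N) (ks : List (Fin N)) (hks : ks.Nodup)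
    (φ : Bits N → ℂ) (hφ : ∀ x, φ x ≠ 0 → ∀ j ∉ ks, x j = 0) (hn : ∑ x, ‖φ x‖ ^ 2 = 1) :
    ∃ circ : Circuit N, circ.length ≤ 6 * 2 ^ ks.length ∧
      Circuit.toMatrix circ *ᵥ ket 0 = φ := by
  induction ks generalizing φ with
  | nil =>
    have h0 : ∀ x, x ≠ 0 → φ x = 0 := by
      intro x hx
      by_contra h
      exact hx (funext fun j => hφ x h j (by simp))
    have h1 : ‖φ 0‖ = 1 := by
      rw [Finset.sum_eq_single 0 (fun x _ hx => by simp [h0 x hx]) (by simp)] at hn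
      exact (pow_eq_one_iff_of_nonneg (norm_nonneg _) two_ne_zero).mp hn
    -- Only a global phase is left, and `k₀` provides a qubit to carry it.
    obtain ⟨c, hc, h⟩ := Monomial.diag k₀ fun _ => (φ 0).arg
    refine ⟨c, hc.trans (by simp), ?_⟩
    rw [h]
    have := Complex.norm_mul_exp_arg_mul_I (φ 0)
    rw [h1, Complex.ofReal_one, one_mul] at this
    rw [this]
    ext z
    by_cases hz : z = 0
    · simp [hz, ket_apply]
    · simp [hz, ket_apply, h0]
  | cons k ks ih =>
    obtain ⟨hk, hks⟩ := List.nodup_cons.mp hks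
    -- The amplitudes of two strings differing only at `k` are merged into one of the same total
    -- weight. The smaller state is prepared recursively and a rotation of `k` splits the weights
    -- again.
    choose r ω δ h0 h1 hr using fun x : Bits N => exists_pair_polar (φ x) (φ (Function.update x k 1))
    -- Composing the angles with `res` makes them depend on `ks` alone, and `res` is the identity on
    -- the support of the smaller state.
    set res : Bits N → Bits N := fun x j => if j ∈ ks then x j else 0 with hres
    have hdep : ∀ f : Bits N → ℝ, DependsOnList (fun x => f (res x)) ks := by
      intro f x y hxy
      have : res x = res y := by
        ext j
        by_cases hj : j ∈ ks <;> simp [hres, hj, hxy]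
      simp only [this]
    set ψ : Bits N → ℂ := fun x => if x k = 0 then r x else 0 with hψ
    have hsupp : ∀ x, ψ x ≠ 0 → ∀ j ∉ ks, x j = 0 := by
      intro x hx j hj
      by_cases hxk : x k = 0
      · by_cases hjk : j = k
        · rw [hjk, hxk]
        · have hrx : ‖r x‖ ^ 2 ≠ 0 := by
            simpa [hψ, hxk] using hx
          rw [hr] at hrx
          by_cases hx0 : φ x = 0
          · have : φ (Function.update x k 1) ≠ 0 := by
              intro h; simp [hx0, h] at hrx
            have := hφ _ this j (by simp [hjk, hj])
            rwa [Function.update_of_ne hjk] at this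
          · exact hφ x hx0 j (by simp [hjk, hj])
      · simp [hψ, hxk] at hx
    have hresx : ∀ x, ψ x ≠ 0 → res x = x := by
      intro x hx
      ext j
      by_cases hj : j ∈ ks
      · simp [hres, hj]
      · simp [hres, hj, hsupp x hx j hj]
    have hsplit : ∀ (E : Type) [AddCommMonoid E] (f : Bits N → E),
        ∑ x, f x = ∑ x, if x k = 0 then f x + f (Function.update x k 1) else 0 := by
      intro E _ f
      rw [← Finset.sum_filter, Finset.sum_add_distrib,
        ← Finset.sum_filter_add_sum_filter_not Finset.univ (fun x : Bits N => x k = 0) f]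
      congr 1
      refine Finset.sum_nbij' (fun x => Function.update x k 0) (fun x => Function.update x k 1)
        ?_ ?_ ?_ ?_ ?_
      · simp
      · simp
      · intro x hx
        have hx : x k = 1 := (bit_eq (x k)).resolve_left (by simpa using hx)
        simp [← hx]
      · intro x hx
        have hx : x k = 0 := by simpa using hx
        simp [← hx]
      · intro x hx
        have hx : x k = 1 := (bit_eq (x k)).resolve_left (by simpa using hx)
        simp [← hx]
    have hnorm : ∑ x, ‖ψ x‖ ^ 2 = 1 := by
      rw [← hn, hsplit ℝ fun x => ‖φ x‖ ^ 2]
      refine Finset.sum_congr rfl fun x _ => ?_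
      by_cases hxk : x k = 0 <;> simp [hψ, hxk, hr]
    obtain ⟨c, hc, h⟩ := ih hks ψ hsupp hnorm
    obtain ⟨c', hc', h'⟩ := exists_mux_rotation k ks hk _ _ (hdep ω) (hdep δ)
    refine ⟨c ++ c', ?_, ?_⟩
    · simp only [List.length_append, List.length_cons, pow_succ]; omega
    · rw [Circuit.append_mulVec, h, mulVec_eq_sum]
      conv_rhs => rw [← sum_smul_ket φ, hsplit]
      refine Finset.sum_congr rfl fun x _ => ?_
      by_cases hx0 : ψ x = 0
      · by_cases hxk : x k = 0
        · have hrx : ‖r x‖ ^ 2 = 0 := by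
            simpa [hψ, hxk] using hx0
          rw [hr] at hrx
          have ha : φ x = 0 := by
            have := sq_nonneg ‖φ x‖; have := sq_nonneg ‖φ (Function.update x k 1)‖
            have : ‖φ x‖ ^ 2 = 0 := by linarith
            simpa using this
          have hb : φ (Function.update x k 1) = 0 := by
            have : ‖φ (Function.update x k 1)‖ ^ 2 = 0 := by simpa [ha] using hrx
            simpa using this
          simp [hx0, ha, hb]
        · simp [hx0, hxk]
      · have hxk : x k = 0 := hsupp x hx0 k hk
        rw [h' x hxk, hresx x hx0, if_pos hxk, smul_add, smul_smul, smul_smul]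
        have : ψ x = r x := by simp [hψ, hxk]
        rw [this, h0, h1]

/-! ### Classical reversible circuits -/

section Reversible

open scoped Fin.CommRing

/-- Add the bit `p x` to coordinate `t` of `x`. -/
def tog {ι : Type*} [DecidableEq ι] (t : ι) (p : (ι → Fin 2) → Fin 2) (x : ι → Fin 2) :
    ι → Fin 2 :=
  Function.update x t (x t + p x)

/-- `Rev s f` means that `f` is computed by a reversible circuit of at most `s` NOT, CNOT and
Toffoli gates acting on wires labelled by `ι`. -/
inductive Rev {ι : Type*} [DecidableEq ι] : ℕ → ((ι → Fin 2) → (ι → Fin 2)) → Prop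
  | refl : Rev 0 id
  | not (t : ι) : Rev 1 (tog t fun _ => 1)
  | cnot (a t : ι) : a ≠ t → Rev 1 (tog t fun x => x a)
  | toffoli (a b t : ι) : a ≠ t → b ≠ t → a ≠ b → Rev 1 (tog t fun x => x a * x b)
  | comp {s s' : ℕ} {f g : (ι → Fin 2) → (ι → Fin 2)} : Rev s f → Rev s' g → Rev (s + s') (g ∘ f)
  | mono {s s' : ℕ} {f : (ι → Fin 2) → (ι → Fin 2)} : Rev s f → s ≤ s' → Rev s' f

theorem bit_add_self (b : Fin 2) : b + b = 0 := by
  rcases bit_eq b with h | h <;> simp [h]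

theorem Rev.monomial {N s : ℕ} {f : Bits N → Bits N} (h : Rev s f) : Monomial (17 * s) f 1 := by
  induction h with
  | refl => exact Monomial.refl
  | not t => exact (Monomial.not t).mono (by norm_num)
  | cnot a t h => exact (Monomial.cnot a t h).mono (by norm_num)
  | toffoli a b t h h' h'' => exact Monomial.toffoli a b t h h' h''
  | comp _ _ ih ih' =>
    exact ((ih.comp ih').mono (by ring_nf; rfl)).congr (fun _ => rfl) fun x => by simp
  | mono _ hs ih => exact ih.mono (by omega)

section

variable {ι κ : Type*} [DecidableEq ι] [DecidableEq κ]

theorem tog_self (t : ι) (p : (ι → Fin 2) → Fin 2) (x : ι → Fin 2) :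
    tog t p x t = x t + p x := by simp [tog]

theorem tog_of_ne {t j : ι} (h : j ≠ t) (p : (ι → Fin 2) → Fin 2) (x : ι → Fin 2) :
    tog t p x j = x j := by simp [tog, h]

theorem tog_tog {t : ι} {p : (ι → Fin 2) → Fin 2} (hp : ∀ x b, p (Function.update x t b) = p x)
    (x : ι → Fin 2) : tog t p (tog t p x) = x := by
  ext1 j
  by_cases h : j = t
  · subst h
    rw [tog_self, tog_self]
    have : p (tog j p x) = p x := hp _ _
    rw [this, add_assoc, bit_add_self, add_zero]
  · rw [tog_of_ne h, tog_of_ne h]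

namespace Rev

theorem congr {s : ℕ} {f g : (ι → Fin 2) → (ι → Fin 2)} (h : Rev s f) (hfg : ∀ x, f x = g x) :
    Rev s g := by
  rwa [← funext hfg]

/-- Relabelling the wires along an embedding. -/
theorem transport (e : ι ↪ κ) {s : ℕ} {f : (ι → Fin 2) → (ι → Fin 2)} (h : Rev s f) :
    ∃ g : (κ → Fin 2) → (κ → Fin 2), Rev s g ∧
      (∀ y, g y ∘ e = f (y ∘ e)) ∧ ∀ y, ∀ j ∉ Set.range e, g y j = y j := by
  have key : ∀ (t : ι) (p : (ι → Fin 2) → Fin 2),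
      (∀ y, tog (e t) (fun y => p (y ∘ e)) y ∘ e = tog t p (y ∘ e)) ∧
      ∀ y, ∀ j ∉ Set.range e, tog (e t) (fun y => p (y ∘ e)) y j = y j := by
    refine fun t p => ⟨fun y => ?_, fun y j hj => tog_of_ne (by rintro rfl; simp at hj) _ _⟩
    ext1 j
    by_cases h : j = t
    · subst h; simp [tog_self]
    · rw [tog_of_ne h, Function.comp_apply, tog_of_ne (by simpa using h)]; rfl
  induction h with
  | refl => exact ⟨id, .refl, fun _ => rfl, fun _ _ _ => rfl⟩
  | not t => exact ⟨_, .not (e t), key t fun _ => 1⟩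
  | cnot a t h => exact ⟨_, .cnot (e a) (e t) (by simpa using h), key t fun x => x a⟩
  | toffoli a b t h h' h'' =>
    exact ⟨_, .toffoli (e a) (e b) (e t) (by simpa using h) (by simpa using h')
      (by simpa using h''), key t fun x => x a * x b⟩
  | comp _ _ ih ih' =>
    obtain ⟨f, hf, h1, h2⟩ := ih
    obtain ⟨g, hg, h3, h4⟩ := ih'
    refine ⟨g ∘ f, .comp hf hg, fun y => ?_, fun y j hj => ?_⟩
    · rw [Function.comp_apply, h3, h1]; rfl
    · rw [Function.comp_apply, h4 _ j hj, h2 _ j hj]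
  | mono _ hs ih =>
    obtain ⟨f, hf, h⟩ := ih
    exact ⟨f, hf.mono hs, h⟩

/-- A family of toggles whose conditions do not involve the toggled coordinates. -/
theorem sum {α : Type*} (I : Finset α) (t : α → ι) (p : α → (ι → Fin 2) → Fin 2) (K : ℕ)
    (hrev : ∀ a ∈ I, Rev K (tog (t a) (p a)))
    (hp : ∀ a ∈ I, ∀ x y, (∀ j, (∀ b ∈ I, t b ≠ j) → x j = y j) → p a x = p a y) :
    Rev (I.card * K) (fun x j => x j + ∑ a ∈ I, if t a = j then p a x else 0) := by
  classical
  suffices H : ∀ J : Finset α, J ⊆ I →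
      Rev (J.card * K) (fun x j => x j + ∑ a ∈ J, if t a = j then p a x else 0) from H I subset_rfl
  intro J
  induction J using Finset.induction_on with
  | empty => exact fun _ => (refl.mono (by simp)).congr fun x => by simp
  | insert a J ha ih =>
    intro hJ
    have haI := hJ (Finset.mem_insert_self _ _)
    refine (((ih fun b hb => hJ (Finset.mem_insert_of_mem hb)).comp (hrev a haI)).mono ?_).congr ?_
    · rw [Finset.card_insert_of_notMem ha, add_mul, one_mul]
    · intro x
      have hpa : p a (fun j => x j + ∑ a ∈ J, if t a = j then p a x else 0) = p a x := by
        refine hp a haI _ _ fun j hj => ?_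
        rw [Finset.sum_eq_zero, add_zero]
        intro b hb
        rw [if_neg (hj b (hJ (Finset.mem_insert_of_mem hb)))]
      ext1 j
      rw [Function.comp_apply, Finset.sum_insert ha]
      by_cases hj : j = t a
      · subst hj
        rw [tog_self, hpa, if_pos rfl, add_assoc, add_comm (p a x)]
      · rw [tog_of_ne hj, if_neg (Ne.symm hj), zero_add]

end Rev

/-! ### Multiply controlled NOT gates with borrowed wires -/

/-- The product of the control bits of a ladder with bottom wire `b`. -/
def ladderProd (b : ι) : List (ι × ι) → (ι → Fin 2) → Fin 2
  | [], x => x b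
  | q :: l, x => x q.1 * ladderProd b l x

/-- The top wire of a ladder with bottom wire `b`. -/
def ladderTop (b : ι) : List (ι × ι) → ι
  | [] => b
  | q :: _ => q.2

/-- A ladder of pairs (control, work wire) all of whose wires are different. -/
def IsLadder (b : ι) : List (ι × ι) → Prop
  | [] => True
  | q :: l => IsLadder b l ∧ q.1 ≠ b ∧ q.2 ≠ b ∧ q.1 ≠ q.2 ∧
      ∀ r ∈ l, q.1 ≠ r.2 ∧ q.2 ≠ r.1 ∧ q.2 ≠ r.2

/-- The Toffoli gate at the top of a ladder. -/
def ladderStep (b : ι) (q : ι × ι) (l : List (ι × ι)) : (ι → Fin 2) → (ι → Fin 2) :=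
  tog q.2 fun x => x q.1 * x (ladderTop b l)

/-- The palindromic sequence of Toffoli gates of a ladder. -/
def ladderMap (b : ι) : List (ι × ι) → (ι → Fin 2) → (ι → Fin 2)
  | [] => id
  | [q] => ladderStep b q []
  | q :: r :: l => ladderStep b q (r :: l) ∘ ladderMap b (r :: l) ∘ ladderStep b q (r :: l)

theorem ladderTop_ne {ι : Type*} {b : ι} {q : ι × ι} {l : List (ι × ι)} (h : IsLadder b (q :: l)) :
    q.1 ≠ ladderTop b l ∧ q.2 ≠ ladderTop b l := by
  obtain ⟨-, h1, h2, -, h3⟩ := h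
  cases l with
  | nil => exact ⟨h1, h2⟩
  | cons r l => exact ⟨(h3 r (by simp)).1, (h3 r (by simp)).2.2⟩

theorem ladderStep_rev {b : ι} {q : ι × ι} {l : List (ι × ι)} (h : IsLadder b (q :: l)) :
    Rev 1 (ladderStep b q l) :=
  .toffoli _ _ _ h.2.2.2.1 (ladderTop_ne h).2.symm (ladderTop_ne h).1

theorem ladderStep_step {b : ι} {q : ι × ι} {l : List (ι × ι)} (h : IsLadder b (q :: l))
    (x : ι → Fin 2) : ladderStep b q l (ladderStep b q l x) = x :=
  tog_tog (fun x c => by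
    rw [Function.update_of_ne h.2.2.2.1, Function.update_of_ne (ladderTop_ne h).2.symm]) x

theorem ladderMap_rev {b : ι} (l : List (ι × ι)) (h : IsLadder b l) :
    Rev (2 * l.length) (ladderMap b l) := by
  induction l with
  | nil => exact .refl
  | cons q l ih =>
    cases l with
    | nil => exact (ladderStep_rev h).mono (by simp)
    | cons r l =>
      exact (((ladderStep_rev h).comp (ih h.1)).comp (ladderStep_rev h)).mono (by simp; omega)

theorem ladderMap_map {b : ι} (l : List (ι × ι)) (h : IsLadder b l) (x : ι → Fin 2) :
    ladderMap b l (ladderMap b l x) = x := by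
  induction l generalizing x with
  | nil => rfl
  | cons q l ih =>
    cases l with
    | nil => exact ladderStep_step h x
    | cons r l =>
      simp only [ladderMap, Function.comp_apply, ladderStep_step h]
      rw [ih h.1, ladderStep_step h]

theorem ladderProd_congr {ι : Type*} {b : ι} {l : List (ι × ι)} {x y : ι → Fin 2} (hb : x b = y b)
    (h : ∀ r ∈ l, x r.1 = y r.1) : ladderProd b l x = ladderProd b l y := by
  induction l with
  | nil => exact hb
  | cons q l ih =>
    rw [ladderProd, ladderProd, h q (by simp), ih fun r hr => h r (by simp [hr])]

/-- The top Toffoli acts before and after the inner ladder, so the top wire receives its control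
times the change of the inner top wire, whatever that wire held: work wires need no initialisation.
The last clause lets `Rev.ladder` move the update of the top wire past the inner ladder. -/
theorem ladderMap_spec {b : ι} (l : List (ι × ι)) (h : IsLadder b l) (x : ι → Fin 2) :
    (∀ j, (∀ r ∈ l, j ≠ r.2) → ladderMap b l x j = x j) ∧
    (l ≠ [] → ladderMap b l x (ladderTop b l) = x (ladderTop b l) + ladderProd b l x) ∧
    (∀ j, (∀ r ∈ l, j ≠ r.2 ∧ j ≠ r.1) → j ≠ b → ∀ c,
      ladderMap b l (Function.update x j c) = Function.update (ladderMap b l x) j c) := by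
  induction l generalizing x with
  | nil => exact ⟨fun _ _ => rfl, by simp, fun _ _ _ _ => rfl⟩
  | cons q l ih =>
    have hcomm : ∀ y : ι → Fin 2, ∀ j, (∀ r ∈ q :: l, j ≠ r.2 ∧ j ≠ r.1) → j ≠ b → ∀ c,
        ladderStep b q l (Function.update y j c) = Function.update (ladderStep b q l y) j c := by
      intro y j hj hb c
      have h1 : ladderTop b l ≠ j := by
        cases l with
        | nil => exact hb.symm
        | cons r l => exact (hj r (by simp)).1.symm
      have h2 := hj q (by simp)
      rw [ladderStep, tog, tog, Function.update_of_ne h1, Function.update_of_ne h2.1.symm,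
        Function.update_of_ne h2.2.symm, Function.update_comm h2.1]
    cases l with
    | nil =>
      refine ⟨fun j hj => ?_, fun _ => ?_, hcomm x⟩
      · rw [ladderMap, ladderStep, tog_of_ne (hj q (by simp))]
      · exact tog_self q.2 (fun y => y q.1 * y b) x
    | cons r l =>
      have hne := ladderTop_ne h
      have hl := h.1
      refine ⟨fun j hj => ?_, fun _ => ?_, fun j hj hb c => ?_⟩
      · have hq := hj q (by simp)
        simp only [ladderMap, Function.comp_apply]
        rw [ladderStep, tog_of_ne hq, (ih hl _).1 j fun r hr => hj r (by simp [hr]),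
          tog_of_ne hq]
      · have e1 : ∀ y, ladderMap b (r :: l) y q.2 = y q.2 := fun y =>
          (ih hl y).1 _ fun s hs => (h.2.2.2.2 s hs).2.2
        have e2 : ∀ y, ladderMap b (r :: l) y q.1 = y q.1 := fun y =>
          (ih hl y).1 _ fun s hs => (h.2.2.2.2 s hs).1
        have e3 : ladderProd b (r :: l) (ladderStep b q (r :: l) x) = ladderProd b (r :: l) x :=
          ladderProd_congr (tog_of_ne h.2.2.1.symm _ _)
            fun s hs => tog_of_ne (h.2.2.2.2 s hs).2.1.symm _ _
        change ladderStep b q (r :: l) (ladderMap b (r :: l) (ladderStep b q (r :: l) x)) q.2 = _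
        conv_lhs => rw [ladderStep, tog_self]
        rw [← ladderStep, e1, e2, (ih hl _).2.1 (by simp), e3]
        rw [ladderStep, tog_self, tog_of_ne h.2.2.2.1, tog_of_ne hne.2.symm, mul_add, add_assoc,
          ← add_assoc (x q.1 * x (ladderTop b (r :: l))), bit_add_self, zero_add]
        rfl
      · simp only [ladderMap, Function.comp_apply]
        rw [hcomm x j hj hb c, (ih hl _).2.2 j (fun s hs => hj s (by simp [hs])) hb,
          hcomm _ j hj hb c]

/-- A toggle controlled by all controls of a ladder. -/
theorem Rev.ladder {b : ι} (q : ι × ι) (l : List (ι × ι)) (h : IsLadder b (q :: l)) :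
    Rev (4 * l.length + 2) (tog q.2 (ladderProd b (q :: l))) := by
  -- Running the ladder without its top pair once more restores the lower work wires.
  refine (((ladderMap_rev _ h).comp (ladderMap_rev l h.1)).mono (by simp; omega)).congr fun x => ?_
  ext1 j
  have hq : ∀ y, ladderMap b l y q.2 = y q.2 := fun y =>
    (ladderMap_spec l h.1 y).1 _ fun s hs => (h.2.2.2.2 s hs).2.2
  by_cases hj : j = q.2
  · rw [hj, tog_self, Function.comp_apply, hq]
    exact (ladderMap_spec _ h x).2.1 (by simp)
  · rw [tog_of_ne hj, Function.comp_apply]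
    have : ∃ c, ladderMap b (q :: l) x = Function.update (ladderMap b l x) q.2 c := by
      have hs : ∀ y : ι → Fin 2, ∃ c, ladderStep b q l y = Function.update y q.2 c :=
        fun y => ⟨_, rfl⟩
      cases l with
      | nil => exact hs x
      | cons r l =>
        obtain ⟨c, hc⟩ := hs x
        obtain ⟨d, hd⟩ := hs (ladderMap b (r :: l) (ladderStep b q (r :: l) x))
        refine ⟨d, ?_⟩
        change ladderStep b q (r :: l) (ladderMap b (r :: l) (ladderStep b q (r :: l) x)) = _
        rw [hd, hc, (ladderMap_spec _ h.1 x).2.2 q.2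
          (fun s hs => ⟨(h.2.2.2.2 s hs).2.2, (h.2.2.2.2 s hs).2.1⟩) h.2.2.1]
        simp
    obtain ⟨c, hc⟩ := this
    rw [hc, (ladderMap_spec l h.1 _).2.2 q.2
      (fun s hs => ⟨(h.2.2.2.2 s hs).2.2, (h.2.2.2.2 s hs).2.1⟩) h.2.2.1,
      Function.update_of_ne hj, ladderMap_map l h.1]

theorem exists_ladder (b : ι) (S D : Finset ι) (hbS : b ∉ S) (hbD : b ∉ D) (hSD : Disjoint S D)
    (hcard : S.card ≤ D.card) : ∃ l : List (ι × ι), IsLadder b l ∧ l.length = S.card ∧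
      (∀ r ∈ l, r.1 ∈ S ∧ r.2 ∈ D) ∧ ∀ x, ladderProd b l x = x b * ∏ j ∈ S, x j := by
  induction S using Finset.induction_on generalizing D with
  | empty => exact ⟨[], trivial, rfl, by simp, by simp [ladderProd]⟩
  | insert c S hc ih =>
    rw [Finset.card_insert_of_notMem hc] at hcard
    obtain ⟨w, hw⟩ : D.Nonempty := Finset.card_pos.mp (by omega)
    rw [Finset.mem_insert, not_or] at hbS
    rw [Finset.disjoint_insert_left] at hSD
    obtain ⟨l, h1, h2, h3, h4⟩ := ih (D.erase w) hbS.2 (by simp [hbD])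
      (Finset.disjoint_of_subset_right (Finset.erase_subset _ _) hSD.2)
      (by rw [Finset.card_erase_of_mem hw]; omega)
    refine ⟨(c, w) :: l, ⟨h1, Ne.symm hbS.1, ?_, ?_, ?_⟩, ?_, ?_, ?_⟩
    · exact fun h => hbD (h ▸ hw)
    · exact fun h => hSD.1 (by rw [show c = w from h]; exact hw)
    · intro r hr
      obtain ⟨hr1, hr2⟩ := h3 r hr
      rw [Finset.mem_erase] at hr2
      refine ⟨?_, ?_, hr2.1.symm⟩
      · rintro rfl; exact hSD.1 hr2.2
      · rintro rfl; exact Finset.disjoint_left.mp hSD.2 hr1 hw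
    · simp [h2, Finset.card_insert_of_notMem hc]
    · intro r hr
      rcases List.mem_cons.mp hr with rfl | hr
      · simp [hw]
      · exact ⟨Finset.mem_insert_of_mem (h3 r hr).1, Finset.mem_of_mem_erase (h3 r hr).2⟩
    · intro x
      rw [ladderProd, h4, Finset.prod_insert hc]
      ring

/-- Multiply controlled NOT with many borrowed wires. -/
theorem Rev.prod_of_many (S D : Finset ι) (t : ι) (htS : t ∉ S) (htD : t ∉ D) (hSD : Disjoint S D)
    (hcard : S.card ≤ D.card + 2) : Rev (4 * S.card + 1) (tog t fun x => ∏ j ∈ S, x j) := by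
  rcases S.eq_empty_or_nonempty with rfl | ⟨b, hb⟩
  · exact ((Rev.not t).mono (by simp)).congr fun x => by simp
  obtain ⟨S, hbS, rfl⟩ : ∃ S', b ∉ S' ∧ S = insert b S' := ⟨S.erase b, by simp, by simp [hb]⟩
  rw [Finset.card_insert_of_notMem hbS] at hcard ⊢
  rw [Finset.mem_insert, not_or] at htS
  rcases S.eq_empty_or_nonempty with rfl | ⟨c, hc⟩
  · exact ((Rev.cnot b t (Ne.symm htS.1)).mono (by simp)).congr fun x => by simp
  obtain ⟨S, hcS, rfl⟩ : ∃ S', c ∉ S' ∧ S = insert c S' := ⟨S.erase c, by simp, by simp [hc]⟩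
  rw [Finset.card_insert_of_notMem hcS] at hcard ⊢
  rw [Finset.mem_insert, not_or] at hbS htS
  rw [Finset.disjoint_insert_left, Finset.disjoint_insert_left] at hSD
  -- Two controls need no work wire: `b` is the bottom of the ladder and `c` is paired with the
  -- target. This is the slack of 2 in `hcard`.
  obtain ⟨l, h1, h2, h3, h4⟩ := exists_ladder b S D hbS.2 hSD.1 hSD.2.2 (by omega)
  have hl : IsLadder b ((c, t) :: l) := by
    refine ⟨h1, Ne.symm hbS.1, htS.1, Ne.symm htS.2.1, fun r hr => ?_⟩
    obtain ⟨hr1, hr2⟩ := h3 r hr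
    refine ⟨?_, ?_, ?_⟩
    · rintro rfl; exact hSD.2.1 hr2
    · rintro rfl; exact htS.2.2 hr1
    · rintro rfl; exact htD hr2
  refine ((Rev.ladder (c, t) l hl).mono (by omega)).congr fun x => ?_
  simp only [tog, ladderProd, h4]
  rw [Finset.prod_insert (by simp [hbS]), Finset.prod_insert hcS]
  ring_nf

/-- Multiply controlled NOT with a single borrowed wire. -/
theorem Rev.prod (S : Finset ι) (t w : ι) (htS : t ∉ S) (hwS : w ∉ S) (hwt : w ≠ t) :
    Rev (8 * S.card + 12) (tog t fun x => ∏ j ∈ S, x j) := by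
  -- The controls are halved so that each half can serve as borrowed work wires for the other.
  obtain ⟨S₁, hS₁, hcard⟩ := Finset.exists_subset_card_eq (s := S) (n := S.card / 2) (by omega)
  have hdisj : Disjoint S₁ (S \ S₁) := Finset.disjoint_sdiff
  have hcard₂ : (S \ S₁).card = S.card - S.card / 2 := by
    rw [Finset.card_sdiff_of_subset hS₁, hcard]
  set S₂ := S \ S₁ with hS₂
  have hw1 : w ∉ S₁ := fun h => hwS (hS₁ h)
  have ht1 : t ∉ S₁ := fun h => htS (hS₁ h)
  have hw2 : w ∉ S₂ := fun h => hwS (Finset.mem_sdiff.mp h).1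
  have ht2 : t ∉ S₂ := fun h => htS (Finset.mem_sdiff.mp h).1
  have hA := Rev.prod_of_many S₁ S₂ w hw1 hw2 hdisj (by omega)
  have hB := Rev.prod_of_many (insert w S₂) S₁ t (by simp [ht2, hwt.symm]) ht1
    (by rw [Finset.disjoint_insert_left]; exact ⟨hw1, hdisj.symm⟩)
    (by rw [Finset.card_insert_of_notMem hw2]; omega)
  rw [Finset.card_insert_of_notMem hw2] at hB
  -- With A and B the products over the halves, w += A and t += wB are performed twice: t gains (w +
  -- A)B + wB = AB and w returns to its value.
  refine ((((hA.comp hB).comp hA).comp hB).mono (by omega)).congr fun x => ?_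
  have hprod : ∀ (T : Finset ι) (u : ι) (p) (y : ι → Fin 2), u ∉ T →
      ∏ j ∈ T, tog u p y j = ∏ j ∈ T, y j := fun T u p y hu =>
    Finset.prod_congr rfl fun j hj => tog_of_ne (by rintro rfl; exact hu hj) _ _
  have hSp : ∏ j ∈ S, x j = (∏ j ∈ S₁, x j) * ∏ j ∈ S₂, x j := by
    rw [hS₂, mul_comm, Finset.prod_sdiff hS₁]
  ext1 j
  simp only [Function.comp_apply, Finset.prod_insert hw2]
  by_cases hjt : j = t
  · subst hjt
    simp only [tog_self, tog_of_ne hwt.symm, tog_of_ne hwt, hprod _ _ _ _ ht2, hprod _ _ _ _ ht1,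
      hprod _ _ _ _ hw2, hprod _ _ _ _ hw1, hSp]
    generalize ∏ j ∈ S₁, x j = A
    generalize ∏ j ∈ S₂, x j = B
    have h1 := bit_add_self (x w * B)
    have h2 := bit_add_self (A * B)
    linear_combination h1 + h2
  · by_cases hjw : j = w
    · subst hjw
      simp only [tog_self, tog_of_ne hjt, hprod _ _ _ _ ht1, hprod _ _ _ _ hw1]
      rw [add_assoc, bit_add_self, add_zero]
    · simp only [tog_of_ne hjt, tog_of_ne hjw]

/-- NOT gates on a set of wires. -/
theorem Rev.mask (S : Finset ι) (v : ι → Fin 2) :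
    Rev S.card (fun x j => if j ∈ S then x j + v j else x j) := by
  classical
  refine ((Rev.sum (S.filter fun j => v j = 1) id (fun _ _ => 1) 1 (fun j _ => .not j)
    (fun _ _ _ _ _ => rfl)).mono
      (by rw [mul_one]; exact Finset.card_filter_le _ _)).congr fun x => ?_
  ext1 j
  simp only [id, Finset.sum_ite_eq', Finset.mem_filter]
  rcases bit_eq (v j) with h | h <;> by_cases hj : j ∈ S <;> simp [h, hj]

theorem prod_bits_eq {ι : Type*} (S : Finset ι) (x v : ι → Fin 2) :
    ∏ j ∈ S, (x j + (v j + 1)) = if ∀ j ∈ S, x j = v j then 1 else 0 := by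
  split_ifs with h
  · refine Finset.prod_eq_one fun j hj => ?_
    rw [h j hj, ← add_assoc, bit_add_self, zero_add]
  · push Not at h
    obtain ⟨j, hj, hne⟩ := h
    refine Finset.prod_eq_zero hj ?_
    rcases bit_eq (x j) with h | h <;> rcases bit_eq (v j) with h' | h' <;> simp_all

/-- A toggle conditioned on a bit pattern, with one borrowed wire. -/
theorem Rev.pattern (S : Finset ι) (v : ι → Fin 2) (t w : ι) (htS : t ∉ S) (hwS : w ∉ S)
    (hwt : w ≠ t) :
    Rev (10 * S.card + 12) (tog t fun x => if ∀ j ∈ S, x j = v j then 1 else 0) := by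
  have hM := Rev.mask S (fun j => v j + 1)
  refine (((hM.comp (Rev.prod S t w htS hwS hwt)).comp hM).mono (by omega)).congr fun x => ?_
  have : ∏ j ∈ S, (if j ∈ S then x j + (v j + 1) else x j) =
      if ∀ j ∈ S, x j = v j then 1 else 0 := by
    rw [← prod_bits_eq]
    exact Finset.prod_congr rfl fun j hj => if_pos hj
  ext1 j
  simp only [Function.comp_apply]
  by_cases hj : j = t
  · subst hj
    rw [if_neg htS, tog_self, tog_self, this, if_neg htS]
  · simp only [tog_of_ne hj]
    split_ifs
    · rw [add_assoc, bit_add_self, add_zero]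
    · rfl

/-! ### Exchanging bit strings -/

/-- Exchange of two partial bit strings. -/
theorem Rev.partialSwap (S : Finset ι) (w : ι) (hw : w ∉ S) (a b : ι → Fin 2)
    (hab : ¬ ∀ j ∈ S, a j = b j) :
    Rev (12 * S.card + 12) (fun x => if (∀ j ∈ S, x j = a j) ∨ (∀ j ∈ S, x j = b j) then
      (fun j => if j ∈ S then x j + (a j + b j) else x j) else x) := by
  classical
  push Not at hab
  obtain ⟨p, hp, hne⟩ := hab
  have hpab : a p + b p = 1 := by
    rcases bit_eq (a p) with h | h <;> rcases bit_eq (b p) with h' | h' <;> simp_all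
  set S' := S.erase p with hS'
  have hcard : S'.card + 1 = S.card := Finset.card_erase_add_one hp
  -- CNOTs from a pivot `p` at which `a` and `b` differ give both strings the same values on `S'`.
  -- Their exchange becomes one toggle of `p` conditioned on `S'`, and the CNOTs are then undone.
  have hM : Rev S'.card (fun x j => if j ∈ S' then x j + x p * (a j + b j) else x j) := by
    refine ((Rev.sum (S'.filter fun j => a j + b j = 1) id (fun _ x => x p) 1
      (fun j hj => .cnot p j ?_) fun j hj x y h => h p ?_).mono
        (by rw [mul_one]; exact Finset.card_filter_le _ _)).congr fun x => ?_
    · rintro rfl; simp [hS'] at hj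
    · rintro _ h rfl; simp [hS'] at h
    · ext1 j
      simp only [id, Finset.sum_ite_eq', Finset.mem_filter]
      rcases bit_eq (a j + b j) with h | h <;> by_cases hj : j ∈ S' <;> simp [h, hj]
  have hT := Rev.pattern S' (fun j => a j + a p * (a j + b j)) p w (by simp [hS'])
    (fun h => hw (Finset.mem_of_mem_erase h)) (by rintro rfl; exact hw hp)
  refine (((hM.comp hT).comp hM).mono (by omega)).congr fun x => ?_
  have hpS' : p ∉ S' := by simp [hS']
  have hS'S : ∀ j, j ∈ S' ↔ j ≠ p ∧ j ∈ S := fun j => by simp [hS']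
  have hcond : (∀ j ∈ S', (if j ∈ S' then x j + x p * (a j + b j) else x j) =
      a j + a p * (a j + b j)) ↔ ((∀ j ∈ S, x j = a j) ∨ (∀ j ∈ S, x j = b j)) := by
    have bits' : ∀ x y a b : Fin 2, x + y * (a + b) = a + y * (a + b) ↔ x = a := by decide
    have bits'' : ∀ x y a b : Fin 2, x + (y + 1) * (a + b) = a + y * (a + b) ↔ x = b := by decide
    have hx : x p = a p ∨ x p = a p + 1 := by
      rcases bit_eq (a p) with h | h <;> rcases bit_eq (x p) with h' | h' <;> simp_all
    have hbp : b p = a p + 1 := by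
      rcases bit_eq (a p) with h | h <;> rcases bit_eq (b p) with h' | h' <;> simp_all
    have hap : a p ≠ a p + 1 := by
      rcases bit_eq (a p) with h | h <;> simp [h]
    rcases hx with hx | hx
    · have : ¬ ∀ j ∈ S, x j = b j := fun h => hap (by rw [← hbp, ← h p hp, hx])
      simp only [this, or_false]
      refine ⟨fun h j hj => ?_, fun h j hj => ?_⟩
      · by_cases hjp : j = p
        · rw [hjp, hx]
        · have hj' := (hS'S j).mpr ⟨hjp, hj⟩
          have := h j hj'
          rw [if_pos hj', hx, bits'] at this
          exact this
      · rw [if_pos hj, hx, bits']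
        exact h j ((hS'S j).mp hj).2
    · have : ¬ ∀ j ∈ S, x j = a j := fun h => hap (by rw [← hx, h p hp])
      simp only [this, false_or]
      refine ⟨fun h j hj => ?_, fun h j hj => ?_⟩
      · by_cases hjp : j = p
        · rw [hjp, hx, hbp]
        · have hj' := (hS'S j).mpr ⟨hjp, hj⟩
          have := h j hj'
          rw [if_pos hj', hx, bits''] at this
          exact this
      · rw [if_pos hj, hx, bits'']
        exact h j ((hS'S j).mp hj).2
  simp only [Function.comp_apply]
  set y : ι → Fin 2 := fun j => if j ∈ S' then x j + x p * (a j + b j) else x j with hy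
  have hyp : y p = x p := if_neg hpS'
  ext1 j
  rw [tog_self, hyp, if_congr hcond rfl rfl]
  by_cases hj' : j ∈ S'
  · have hjp := ((hS'S j).mp hj').1
    rw [if_pos hj', tog_of_ne hjp]
    have hyj : y j = x j + x p * (a j + b j) := if_pos hj'
    rw [hyj]
    have bits : ∀ x y c : Fin 2, x + y * c + (y + 1) * c = x + c := by decide
    have bits' : ∀ x y c : Fin 2, x + y * c + (y + 0) * c = x := by decide
    split_ifs with h
    · rw [bits]; exact (if_pos ((hS'S j).mp hj').2).symm
    · rw [bits']
  · rw [if_neg hj']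
    by_cases hjp : j = p
    · subst hjp
      rw [tog_self, hyp, if_congr hcond rfl rfl]
      split_ifs with h
      · rw [← hpab]; exact (if_pos hp).symm
      · rw [add_zero]
    · have hjS : j ∉ S := fun h => hj' ((hS'S j).mpr ⟨hjp, h⟩)
      rw [tog_of_ne hjp]
      have hyj : y j = x j := if_neg hj'
      rw [hyj]
      split_ifs
      · exact (if_neg hjS).symm
      · rfl

/-- Simultaneous exchange of disjoint pairs of partial bit strings. -/
theorem Rev.partialSwaps {α : Type*} (S : Finset ι) (w : ι) (hw : w ∉ S) (I : Finset α)
    (u : α × Bool → ι → Fin 2)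
    (hu : ∀ p q, p.1 ∈ I → q.1 ∈ I → (∀ j ∈ S, u p j = u q j) → p = q) :
    ∃ F, Rev (I.card * (12 * S.card + 12)) F ∧
      (∀ x, ∀ i ∈ I, ∀ b, (∀ j ∈ S, x j = u (i, b) j) → F x = S.piecewise (u (i, !b)) x) ∧
      (∀ x, (∀ i ∈ I, ∀ b, ¬ ∀ j ∈ S, x j = u (i, b) j) → F x = x) := by
  classical
  induction I using Finset.induction_on with
  | empty => exact ⟨id, .mono .refl (by simp), by simp, fun _ _ => rfl⟩
  | insert a I ha ih =>
    obtain ⟨F, hF, h1, h2⟩ := ih fun p q hp hq h =>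
      hu p q (Finset.mem_insert_of_mem hp) (Finset.mem_insert_of_mem hq) h
    have haI := Finset.mem_insert_self a I
    have hne : ¬ ∀ j ∈ S, u (a, false) j = u (a, true) j := fun h => by
      simpa using hu _ _ haI haI h
    refine ⟨_, (hF.comp (Rev.partialSwap S w hw _ _ hne)).mono (by
      rw [Finset.card_insert_of_notMem ha, add_mul, one_mul]), ?_, ?_⟩
    · intro x i hi b hx
      rw [Function.comp_apply]
      rcases Finset.mem_insert.mp hi with rfl | hi'
      · have hFx : F x = x := h2 x fun k hk c hc => by
          have := hu (i, b) (k, c) haI (Finset.mem_insert_of_mem hk)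
            fun j hj => by rw [← hx j hj, hc j hj]
          rw [Prod.mk.injEq] at this
          exact ha (this.1 ▸ hk)
        rw [hFx, if_pos (by cases b; exacts [Or.inl hx, Or.inr hx])]
        ext1 j
        by_cases hj : j ∈ S
        · have bits : ∀ a b : Fin 2, a + (a + b) = b ∧ b + (a + b) = a := by decide
          cases b <;> simp [hj, hx j hj, bits]
        · simp [hj]
      · rw [h1 x i hi' b hx, if_neg]
        intro hor
        have : ∃ c, ∀ j ∈ S, u (i, !b) j = u (a, c) j := by
          rcases hor with h | h
          · exact ⟨false, fun j hj => by simpa [hj] using h j hj⟩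
          · exact ⟨true, fun j hj => by simpa [hj] using h j hj⟩
        obtain ⟨c, hc⟩ := this
        have := hu _ _ hi haI hc
        rw [Prod.mk.injEq] at this
        exact ha (this.1 ▸ hi')
    · intro x hx
      rw [Function.comp_apply, h2 x fun i hi => hx i (Finset.mem_insert_of_mem hi), if_neg]
      rintro (h | h)
      · exact hx a haI _ h
      · exact hx a haI _ h

end

end Reversible

/-! ### From batched exchanges to sparse states -/

/-- Any `s` disjoint pairs of `n`-bit strings can be exchanged (the first entries being sent to
the second ones) by `K` reversible gates using `m` clean ancillary wires, all other strings being
fixed. -/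
def BatchSwap (n m s K : ℕ) : Prop :=
  ∀ u : Fin s × Bool → Bits n, Function.Injective u →
    ∃ f : Bits (n + m) → Bits (n + m), Rev K f ∧
      (∀ i, f (Fin.append (u (i, false)) 0) = Fin.append (u (i, true)) 0) ∧
      ∀ z, (∀ p, z ≠ u p) → f (Fin.append z 0) = Fin.append z 0

/-- All sources and targets are distinct and a batch fixes every string outside its own pairs, so
later sources are still in place and earlier results survive. -/
theorem BatchSwap.exists_map {n m s K : ℕ} (h : BatchSwap n m s K) {B : ℕ}
    (x y : Fin B × Fin s → Bits n) (hx : Function.Injective x) (hy : Function.Injective y)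
    (hxy : ∀ p q, x p ≠ y q) :
    ∃ F : Bits (n + m) → Bits (n + m), Rev (B * K) F ∧
      ∀ p, F (Fin.append (x p) 0) = Fin.append (y p) 0 := by
  suffices H : ∀ J : Finset (Fin B), ∃ F : Bits (n + m) → Bits (n + m), Rev (J.card * K) F ∧
      (∀ p, p.1 ∈ J → F (Fin.append (x p) 0) = Fin.append (y p) 0) ∧
      ∀ z, (∀ p, p.1 ∈ J → z ≠ x p ∧ z ≠ y p) → F (Fin.append z 0) = Fin.append z 0 by
    obtain ⟨F, h1, h2, -⟩ := H Finset.univ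
    exact ⟨F, by simpa using h1, fun p => h2 p (Finset.mem_univ _)⟩
  intro J
  induction J using Finset.induction_on with
  | empty => exact ⟨id, .mono .refl (by simp), by simp, fun _ _ => rfl⟩
  | insert a J ha ih =>
    obtain ⟨F, hF, h1, h2⟩ := ih
    obtain ⟨f, hf, h3, h4⟩ := h (fun p => if p.2 then y (a, p.1) else x (a, p.1)) (by
      rintro ⟨i, b⟩ ⟨j, c⟩ hij
      cases b <;> cases c <;> simp at hij
      · simpa using hx hij
      · exact absurd hij (hxy _ _)
      · exact absurd hij.symm (hxy _ _)
      · simpa using hy hij)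
    refine ⟨f ∘ F, (hF.comp hf).mono (by rw [Finset.card_insert_of_notMem ha, add_mul, one_mul]),
      fun p hp => ?_, fun z hz => ?_⟩
    · rw [Function.comp_apply]
      obtain ⟨i, j⟩ := p
      rcases Finset.mem_insert.mp hp with hi | hi
      · obtain rfl : i = a := hi
        rw [h2 _ fun q hq => ⟨fun e => ?_, hxy _ _⟩]
        · simpa using h3 j
        · have := hx e
          subst this
          exact ha hq
      · rw [h1 _ hi, h4]
        rintro ⟨k, b⟩ e
        cases b <;> simp at e
        · exact hxy _ _ e.symm
        · have := hy e
          simp only [Prod.mk.injEq] at this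
          have hi' : i ∈ J := hi
          rw [this.1] at hi'
          exact ha hi'
    · rw [Function.comp_apply, h2 z fun p hp => hz p (Finset.mem_insert_of_mem hp), h4]
      rintro ⟨k, b⟩
      have := hz (a, k) (Finset.mem_insert_self _ _)
      cases b <;> simp [this]

theorem sum_smul_ket_apply {N d : ℕ} (α : Fin d → ℂ) (w : Fin d → Bits N)
    (hw : Function.Injective w) :
    (∀ i, (∑ i, α i • ket (w i)) (w i) = α i) ∧
    ∀ x, (∀ i, x ≠ w i) → (∑ i, α i • ket (w i)) x = 0 := by
  refine ⟨fun i => ?_, fun x hx => ?_⟩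
  · simp [Finset.sum_apply, ket_apply, hw.eq_iff]
  · simp [Finset.sum_apply, ket_apply, hx]

/-- A sparse state supported on the span of the first `k` qubits can be prepared with `O(2 ^ k)`
gates. -/
theorem exists_preparation_of_support {n m d : ℕ} (hn : 0 < n) (k : ℕ) (hk : k ≤ n)
    (α : Fin d → ℂ) (w : Fin d → Bits n) (hw : Function.Injective w)
    (hα : ∑ i, ‖α i‖ ^ 2 = 1) (hsupp : ∀ i (j : Fin n), k ≤ (j : ℕ) → w i j = 0) :
    ∃ circ : Circuit (n + m), circ.length ≤ 6 * 2 ^ k ∧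
      Circuit.toMatrix circ *ᵥ ket 0 = ∑ i, α i • ket (Fin.append (w i) (0 : Bits m)) := by
  have hinj : Function.Injective fun i => (Fin.append (w i) (0 : Bits m) : Bits (n + m)) := by
    intro i j hij
    apply hw
    ext1 l
    have := congrFun hij (Fin.castAdd m l)
    simpa using this
  obtain ⟨h1, h2⟩ := sum_smul_ket_apply α _ hinj
  refine (exists_dense_preparation (N := n + m) ⟨0, by omega⟩
    (List.ofFn fun j : Fin k => Fin.castAdd m (Fin.castLE hk j))
    (List.nodup_ofFn.mpr fun i j hij => by simpa using hij)
    (∑ i, α i • ket (Fin.append (w i) (0 : Bits m))) ?_ ?_).imp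
      fun c hc => ⟨by simpa using hc.1, hc.2⟩
  · intro x hx j hj
    by_contra hxj
    apply hx
    apply h2
    rintro i rfl
    apply hxj
    refine Fin.addCases (fun l hl => ?_) (fun l _ => by simp) j hj
    rw [Fin.append_left]
    apply hsupp
    by_contra hlk
    push Not at hlk
    exact hl (by rw [List.mem_ofFn]; exact ⟨⟨l, hlk⟩, rfl⟩)
  · rw [← hα]
    symm
    refine Finset.sum_of_injOn _ hinj.injOn (by simp) (fun x _ hx => ?_) fun i _ => ?_
    · rw [h2 x fun i hi => hx ⟨i, by simp, hi.symm⟩]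
      simp
    · rw [h1]

/-- Pads the target strings so that their number is a multiple of the batch size. -/
theorem exists_injective_extension {A β : Type*} [Fintype A] [Fintype β] {d : ℕ} (e : Fin d ↪ A)
    (q : Fin d → β) (hq : Function.Injective q) (hcard : Fintype.card A ≤ Fintype.card β) :
    ∃ Q : A → β, Function.Injective Q ∧ ∀ i, Q (e i) = q i := by
  classical
  by_cases hβ : Nonempty β
  swap
  · rw [not_nonempty_iff] at hβ
    have : IsEmpty A := by
      rw [← Fintype.card_eq_zero_iff]
      have := Fintype.card_eq_zero_iff.mpr hβ
      omega
    exact ⟨isEmptyElim, fun a => isEmptyElim a, fun i => isEmptyElim (q i)⟩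
  have hd : d ≤ Fintype.card A := by simpa using Fintype.card_le_of_embedding e
  obtain ⟨t, ht1, ht2⟩ := Finset.exists_superset_card_eq (s := Finset.univ.image q)
    (n := Fintype.card A) (by rw [Finset.card_image_of_injective _ hq]; simpa using hd) hcard
  obtain ⟨g, hg⟩ := Finset.exists_equiv_extend_of_card_eq (α := A) (t := t) ht2.symm
    (s := Finset.univ.map e) (f := Function.extend e q fun _ => Classical.arbitrary β) (by
      intro b hb
      obtain ⟨a, ha, rfl⟩ := Finset.mem_image.mp hb
      obtain ⟨i, -, rfl⟩ := Finset.mem_map.mp ha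
      rw [e.injective.extend_apply]
      exact ht1 (Finset.mem_image_of_mem _ (Finset.mem_univ _))) (by
      intro a ha b hb hab
      obtain ⟨i, -, rfl⟩ := Finset.mem_map.mp ha
      obtain ⟨j, -, rfl⟩ := Finset.mem_map.mp hb
      rw [e.injective.extend_apply, e.injective.extend_apply] at hab
      rw [hq hab])
  refine ⟨fun a => g a, Subtype.val_injective.comp g.injective, fun i => ?_⟩
  change ((g (e i) : t) : β) = q i
  rw [hg _ (by simp), e.injective.extend_apply]

/-- Sparse states can be prepared by dense preparation followed by batched swaps. -/
theorem BatchSwap.exists_preparation {n m s K d B : ℕ} (h : BatchSwap n m s K) (hn : 0 < n)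
    (hd : 0 < d) (hB : d ≤ B * s) (α : Fin d → ℂ) (q : Fin d → Bits n)
    (hq : Function.Injective q) (hα : ∑ i, ‖α i‖ ^ 2 = 1) :
    ∃ circ : Circuit (n + m), circ.Prepares α q ∧ circ.length ≤ 24 * (B * s) + 17 * (B * K) := by
  classical
  -- A subcube with at least 2Bs points keeps Bs free sources after the Bs targets are removed;
  -- minimality gives 2^k < 4Bs, hence the term 24Bs.
  set k := Nat.clog 2 (2 * (B * s)) with hk
  have hk1 : 2 * (B * s) ≤ 2 ^ k := Nat.le_pow_clog (by norm_num) _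
  have hk2 : 2 ^ (k - 1) < 2 * (B * s) :=
    Nat.pow_pred_clog_lt_self (by norm_num) (by omega)
  have hk0 : 0 < k := Nat.clog_pos (by norm_num) (by omega)
  have hk3 : 2 ^ k < 4 * (B * s) := by
    obtain ⟨l, hl⟩ : ∃ l, k = l + 1 := ⟨k - 1, by omega⟩
    rw [hl, pow_succ]
    rw [hl, Nat.add_sub_cancel] at hk2
    omega
  -- If the subcube does not fit into n qubits, dense preparation on all of them is within the bound
  -- already.
  rcases Nat.lt_or_ge n k with hnk | hnk
  · obtain ⟨c, hc, hc'⟩ := exists_preparation_of_support (m := m) hn n le_rfl α q hq hα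
      fun i j hj => absurd j.isLt (by omega)
    refine ⟨c, hc', hc.trans ?_⟩
    have : 2 ^ n ≤ 2 ^ k := Nat.pow_le_pow_right (by norm_num) hnk.le
    omega
  obtain ⟨e⟩ : Nonempty (Fin d ↪ Fin B × Fin s) :=
    Function.Embedding.nonempty_of_card_le (by simpa using hB)
  have h2n : 2 ^ k ≤ 2 ^ n := Nat.pow_le_pow_right (by norm_num) hnk
  obtain ⟨Q, hQ, hQq⟩ := exists_injective_extension e q hq (by simp; omega)
  set D : Finset (Bits n) := Finset.univ.image fun (z : Bits k) (j : Fin n) =>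
    if hj : (j : ℕ) < k then z ⟨j, hj⟩ else 0 with hD
  have hDcard : D.card = 2 ^ k := by
    rw [hD, Finset.card_image_of_injective]
    · simp
    · intro a b hab
      ext1 j
      have := congrFun hab ⟨j, by omega⟩
      simpa using this
  have hDQ : B * s ≤ (D \ Finset.univ.image Q).card := by
    have := Finset.le_card_sdiff (Finset.univ.image Q) D
    rw [Finset.card_image_of_injective _ hQ, Finset.card_univ] at this
    simp at this
    omega
  obtain ⟨X⟩ : Nonempty (Fin B × Fin s ↪ (D \ Finset.univ.image Q : Finset (Bits n))) :=
    Function.Embedding.nonempty_of_card_le (by rw [Fintype.card_coe]; simpa using hDQ)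
  have hX := fun p => Finset.mem_sdiff.mp (X p).2
  obtain ⟨F, hF, hFX⟩ := h.exists_map (fun p => (X p : Bits n)) Q
    (Subtype.val_injective.comp X.injective) hQ fun p r hpr => (hX p).2 (by simp [hpr])
  obtain ⟨c, hc, hc'⟩ := exists_preparation_of_support (m := m) hn k hnk α
    (fun i => (X (e i) : Bits n))
    (Subtype.val_injective.comp (X.injective.comp e.injective)) hα (by
      intro i j hj
      obtain ⟨z, -, hz⟩ := Finset.mem_image.mp (hX (e i)).1
      rw [← hz]
      exact dif_neg (by omega))
  obtain ⟨c', hc1, hc2⟩ := hF.monomial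
  refine ⟨c ++ c', ?_, by rw [List.length_append]; omega⟩
  rw [Circuit.Prepares, Circuit.append_mulVec, hc', Matrix.mulVec_sum]
  refine Finset.sum_congr rfl fun i _ => ?_
  rw [Matrix.mulVec_smul, hc2, hFX, hQq]
  simp

/-! ### Few ancillas: compressing a batch by its repeated columns -/

section Compressed

open scoped Fin.CommRing

variable {ι α : Type*} [DecidableEq ι]

/-- Adding to every coordinate outside the image of `ρ` its representative. -/
def foldMap (ρ : ι → ι) (x : ι → Fin 2) (j : ι) : Fin 2 :=
  if ρ j = j then x j else x j + x (ρ j)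

theorem foldMap_foldMap {ρ : ι → ι} (hρ : ∀ j, ρ (ρ j) = ρ j) (x : ι → Fin 2) :
    foldMap ρ (foldMap ρ x) = x := by
  ext1 j
  by_cases h : ρ j = j
  · simp [foldMap, h]
  · simp [foldMap, h, hρ, add_assoc, bit_add_self]

theorem Rev.fold [Fintype ι] {ρ : ι → ι} (hρ : ∀ j, ρ (ρ j) = ρ j) :
    Rev (Fintype.card ι) (foldMap ρ) := by
  refine ((Rev.sum (Finset.univ.filter fun j => ρ j ≠ j) id (fun j x => x (ρ j)) 1
    (fun j hj => .cnot _ _ ?_) fun j _ x y h => h _ fun b hb => ?_).mono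
      (by rw [mul_one]; exact Finset.card_le_univ _)).congr fun x => ?_
  · exact (Finset.mem_filter.mp hj).2
  · rintro rfl
    exact (Finset.mem_filter.mp hb).2 (hρ j)
  · ext1 j
    by_cases h : ρ j = j <;> simp [foldMap, h]

/-- The properties of a simultaneous exchange of partial bit strings. -/
structure IsPartialSwap {β : Type*} (S : Finset ι) (u : β × Bool → ι → Fin 2)
    (F : (ι → Fin 2) → (ι → Fin 2)) : Prop where
  swap : ∀ x i b, (∀ j ∈ S, x j = u (i, b) j) → F x = S.piecewise (u (i, !b)) x
  fixed : ∀ x, (∀ i b, ¬ ∀ j ∈ S, x j = u (i, b) j) → F x = x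

namespace IsPartialSwap

variable {β : Type*} {S : Finset ι} {u : β × Bool → ι → Fin 2} {F : (ι → Fin 2) → (ι → Fin 2)}

theorem apply_of_notMem (h : IsPartialSwap S u F) (x : ι → Fin 2) {j : ι} (hj : j ∉ S) :
    F x j = x j := by
  by_cases hx : ∃ i b, ∀ j ∈ S, x j = u (i, b) j
  · obtain ⟨i, b, hx⟩ := hx
    rw [h.swap x i b hx, Finset.piecewise_eq_of_notMem _ _ _ hj]
  · push Not at hx
    rw [h.fixed x fun i b hc => by obtain ⟨j, hj, hne⟩ := hx i b; exact hne (hc j hj)]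

theorem apply_apply (h : IsPartialSwap S u F) (x : ι → Fin 2) : F (F x) = x := by
  by_cases hx : ∃ i b, ∀ j ∈ S, x j = u (i, b) j
  · obtain ⟨i, b, hx⟩ := hx
    rw [h.swap x i b hx, h.swap _ i (!b) fun j hj => Finset.piecewise_eq_of_mem _ _ _ hj]
    ext1 j
    by_cases hj : j ∈ S
    · simp [hj, hx j hj]
    · simp [hj]
  · push Not at hx
    have := h.fixed x fun i b hc => by obtain ⟨j, hj, hne⟩ := hx i b; exact hne (hc j hj)
    rw [this, this]

theorem apply_const (h : IsPartialSwap S u F) {k : ι} (hk : k ∈ S) {c : Fin 2}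
    (hu : ∀ p, u p k = c) (x : ι → Fin 2) : F x k = x k := by
  by_cases hx : ∃ i b, ∀ j ∈ S, x j = u (i, b) j
  · obtain ⟨i, b, hx⟩ := hx
    rw [h.swap x i b hx, Finset.piecewise_eq_of_mem _ _ _ hk, hx k hk, hu, hu]
  · push Not at hx
    rw [h.fixed x fun i b hc => by obtain ⟨j, hj, hne⟩ := hx i b; exact hne (hc j hj)]

theorem eq_self (h : IsPartialSwap S u F) {k : ι} (hk : k ∈ S) {c : Fin 2} (hu : ∀ p, u p k = c)
    {x : ι → Fin 2} (hx : x k ≠ c) : F x = x :=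
  h.fixed x fun i b hc => hx (by rw [hc k hk, hu])

end IsPartialSwap

/-- Quadruples of bit strings which are constant on the fibres of a map `ρ` with small image are
exchanged in pairs: `v ((i, c), false)` and `v ((i, c), true)` are swapped. The conditioning on
the remaining coordinates is done with a commutator of two controlled exchanges, using the borrowed
wire `k`. -/
theorem Rev.quadSwap [Fintype ι] [Fintype α] (v : (α × Bool) × Bool → ι → Fin 2)
    (hv : Function.Injective v) (ρ : ι → ι) (hρ : ∀ j, ρ (ρ j) = ρ j)
    (hvρ : ∀ p j, v p (ρ j) = v p j) (k w : ι) (hk : ∀ j, ρ j ≠ k) (hw : ∀ j, ρ j ≠ w)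
    (hkw : k ≠ w) :
    ∃ f, Rev (42 * Fintype.card ι + 48 +
        6 * (Fintype.card α * (12 * (Finset.univ.image ρ).card + 24))) f ∧
      (∀ i, f (v (i, false)) = v (i, true)) ∧ ∀ z, (∀ p, z ≠ v p) → f z = z := by
  set P := Finset.univ.image ρ with hP
  have hkP : k ∉ P := by simp [hP, hk]
  have hwP : w ∉ P := by simp [hP, hw]
  set S := insert k P with hS
  have hkS : k ∈ S := Finset.mem_insert_self _ _
  have hPS : P ⊆ S := Finset.subset_insert _ _
  have hwS : w ∉ S := by simp [hS, hwP, Ne.symm hkw]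
  have hScard : S.card = P.card + 1 := Finset.card_insert_of_notMem hkP
  set R : Finset ι := Finset.univ \ S with hR
  have hkR : k ∉ R := by simp [hR, hkS]
  have hvP : ∀ p q, (∀ j ∈ P, v p j = v q j) → p = q := fun p q h => hv <| by
    ext1 j
    rw [← hvρ p j, ← hvρ q j]
    exact h _ (by simp [hP])
  -- the two controlled exchanges
  set u₀ : α × Bool → ι → Fin 2 := fun p => Function.update (v ((p.1, false), p.2)) k 0 with hu₀
  set u₁ : (α × Bool) × Bool → ι → Fin 2 :=
    fun p => Function.update (v ((p.1.1, p.2), p.1.2)) k 1 with hu₁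
  have hne : ∀ j ∈ P, j ≠ k := fun j hj h => hkP (h ▸ hj)
  obtain ⟨D, hD, hD1, hD2⟩ := Rev.partialSwaps S w hwS (Finset.univ : Finset α) u₀ (by
    rintro ⟨i, b⟩ ⟨i', b'⟩ - - h
    have := hvP ((i, false), b) ((i', false), b') fun j hj => by
      simpa [hu₀, hne j hj] using h j (hPS hj)
    simpa using this)
  obtain ⟨E, hE, hE1, hE2⟩ := Rev.partialSwaps S w hwS (Finset.univ : Finset (α × Bool)) u₁ (by
    rintro ⟨⟨i, b⟩, c⟩ ⟨⟨i', b'⟩, c'⟩ - - h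
    have := hvP ((i, c), b) ((i', c'), b') fun j hj => by
      simpa [hu₁, hne j hj] using h j (hPS hj)
    simp only [Prod.mk.injEq] at this ⊢
    tauto)
  have hD : IsPartialSwap S u₀ D ∧ Rev _ D :=
    ⟨⟨fun x i => hD1 x i (Finset.mem_univ _), fun x h => hD2 x fun i _ => h i⟩, hD⟩
  have hE : IsPartialSwap S u₁ E ∧ Rev _ E :=
    ⟨⟨fun x i => hE1 x i (Finset.mem_univ _), fun x h => hE2 x fun i _ => h i⟩, hE⟩
  clear hD1 hD2 hE1 hE2
  obtain ⟨hDs, hD⟩ := hD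
  obtain ⟨hEs, hE⟩ := hE
  have hu₀k : ∀ p, u₀ p k = 0 := fun p => by simp [hu₀]
  have hu₁k : ∀ p, u₁ p k = 1 := fun p => by simp [hu₁]
  set T := tog k fun x : ι → Fin 2 => if ∀ j ∈ R, x j = 0 then 1 else 0 with hT
  have hTrev : Rev (10 * Fintype.card ι + 12) T := by
    -- The wire `ρ k` can be borrowed: it lies in `P`, hence outside `R`, and differs from `k`.
    refine (Rev.pattern R 0 k (ρ k) hkR (by simp [hR, hS, hP]) (hk k)).mono (s' := 10 * Fintype.card ι + 12) ?_
      |>.congr fun x => by simp only [hT, tog, Pi.zero_apply]; congr!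
    have := Finset.card_le_univ R
    omega
  have hT1 : ∀ x, (∀ j ∈ R, x j = 0) → T x = Function.update x k (x k + 1) := by
    intro x hx
    simp only [hT, tog]
    rw [if_pos hx]
  have hT0 : ∀ x, (¬ ∀ j ∈ R, x j = 0) → T x = x := by
    intro x hx
    simp only [hT, tog]
    rw [if_neg hx, add_zero, Function.update_eq_self]
  -- `D` acts only when k = 0, `E` only when k = 1, and both preserve k. If `R` is not all zero, `T`
  -- is idle and W² is the square of one of these involutions. If `R` is zero and k = 1, W is the
  -- identity. If `R` is zero and k = 0, W is `D` followed by `E`: a 4-cycle on each compressed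
  -- quadruple, whose square is the desired pair of exchanges.
  set W : (ι → Fin 2) → (ι → Fin 2) := fun x => T (E (T (D x))) with hW
  have hA := Rev.fold (ι := ι) hρ
  refine ⟨fun x => foldMap ρ (W (W (foldMap ρ x))), ?_, ?_⟩
  · have hW' := ((hD.comp hTrev).comp hE).comp hTrev
    refine (((hA.comp hW').comp hW').comp hA).mono ?_
    rw [Finset.card_univ, Finset.card_univ, Fintype.card_prod, Fintype.card_bool, hScard]
    have : Fintype.card α * (12 * (P.card + 1) + 12) = Fintype.card α * (12 * P.card + 24) := by
      ring
    have h2 : Fintype.card α * 2 * (12 * (P.card + 1) + 12) =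
      2 * (Fintype.card α * (12 * P.card + 24)) := by ring
    rw [this, h2]
    omega
  -- the compressed strings
  set st : (α × Bool) × Bool → Fin 2 → ι → Fin 2 :=
    fun p c j => if j ∈ P then v p j else if j = k then c else 0 with hst
  have hfold : ∀ p, foldMap ρ (v p) = st p 0 := by
    intro p
    ext1 j
    by_cases h : ρ j = j
    · have : j ∈ P := by rw [hP, ← h]; simp
      simp [foldMap, h, hst, this]
    · have : j ∉ P := fun hj => by
        obtain ⟨i, -, rfl⟩ := Finset.mem_image.mp hj
        exact h (hρ i)
      simp [foldMap, h, hst, this, hvρ, bit_add_self]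
  have hstR : ∀ p c, ∀ j ∈ R, st p c j = 0 := by
    intro p c j hj
    have hjS : j ∉ S := (Finset.mem_sdiff.mp hj).2
    have hjP : j ∉ P := fun h => hjS (hPS h)
    have hjk : j ≠ k := by rintro rfl; exact hkR hj
    simp [hst, hjP, hjk]
  have hstk : ∀ p c, st p c k = c := fun p c => by simp [hst, hkP]
  have hTst : ∀ p c, T (st p c) = st p (c + 1) := by
    intro p c
    rw [hT1 _ (hstR p c), hstk]
    ext1 j
    by_cases hj : j = k
    · subst hj; simp [hstk]
    · simp [hst, hj]
  have hDst : ∀ i b, D (st ((i, false), b) 0) = st ((i, false), !b) 0 := by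
    intro i b
    rw [hDs.swap _ i b fun j hj => ?_]
    · ext1 j
      by_cases hj : j ∈ S
      · rw [Finset.piecewise_eq_of_mem _ _ _ hj]
        rcases Finset.mem_insert.mp hj with rfl | hj
        · rw [hu₀k, hstk]
        · simp [hu₀, hst, hj, hne j hj]
      · have hjP : j ∉ P := fun h => hj (hPS h)
        simp [hj, hst, hjP]
    · rcases Finset.mem_insert.mp hj with rfl | hj
      · rw [hu₀k, hstk]
      · simp [hu₀, hst, hj, hne j hj]
  have hEst : ∀ i b c, E (st ((i, c), b) 1) = st ((i, !c), b) 1 := by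
    intro i b c
    rw [hEs.swap _ (i, b) c fun j hj => ?_]
    · ext1 j
      by_cases hj : j ∈ S
      · rw [Finset.piecewise_eq_of_mem _ _ _ hj]
        rcases Finset.mem_insert.mp hj with rfl | hj
        · rw [hu₁k, hstk]
        · simp [hu₁, hst, hj, hne j hj]
      · have hjP : j ∉ P := fun h => hj (hPS h)
        simp [hj, hst, hjP]
    · rcases Finset.mem_insert.mp hj with rfl | hj
      · rw [hu₁k, hstk]
      · simp [hu₁, hst, hj, hne j hj]
  have hDst' : ∀ i b, D (st ((i, true), b) 0) = st ((i, true), b) 0 := by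
    intro i b
    refine hDs.fixed _ fun i' b' h => ?_
    have := hvP ((i, true), b) ((i', false), b') fun j hj => by
      simpa [hu₀, hst, hj, hne j hj] using h j (hPS hj)
    simp at this
  have h01 : (0 : Fin 2) + 1 = 1 := rfl
  have h11 : (1 : Fin 2) + 1 = 0 := rfl
  have hW0 : ∀ i b, W (st ((i, false), b) 0) = st ((i, true), !b) 0 := by
    intro i b
    simp only [hW]
    rw [hDst, hTst, h01, hEst, hTst, h11]; rfl
  have hW1 : ∀ i b, W (st ((i, true), b) 0) = st ((i, false), b) 0 := by
    intro i b
    simp only [hW]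
    rw [hDst', hTst, h01, hEst, hTst, h11]; rfl
  refine ⟨?_, fun z hz => ?_⟩
  · rintro ⟨i, c⟩
    simp only [hfold]
    cases c
    · rw [hW0, hW1, ← hfold, foldMap_foldMap hρ]; rfl
    · rw [hW1, hW0, ← hfold, foldMap_foldMap hρ]; rfl
  -- all other strings are fixed
  have hx : ∀ p, foldMap ρ z ≠ st p 0 := fun p h => hz p <| by
    rw [← foldMap_foldMap hρ z, h, ← hfold, foldMap_foldMap hρ]
  suffices H : W (W (foldMap ρ z)) = foldMap ρ z by
    simp only [H, foldMap_foldMap hρ]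
  generalize foldMap ρ z = x at hx
  by_cases hxR : ∀ j ∈ R, x j = 0
  · suffices H : W x = x by rw [H, H]
    have hup : ∀ c, ∀ j ∈ R, Function.update x k c j = 0 := fun c j hj => by
      rw [Function.update_of_ne (by rintro rfl; exact hkR hj), hxR j hj]
    rcases bit_eq (x k) with hxk | hxk
    · have hno : ∀ p, ¬ ∀ j ∈ P, x j = v p j := by
        intro p hp
        apply hx p
        ext1 j
        by_cases hj : j ∈ P
        · simp [hst, hj, hp j hj]
        · by_cases hjk : j = k
          · rw [hjk, hxk, hstk]
          · rw [hxR j (by simp [hR, hS, hj, hjk]), hst]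
            simp [hj, hjk]
      have hDx : D x = x := hDs.fixed x fun i b h => hno ((i, false), b) fun j hj => by
        rw [h j (hPS hj)]; simp [hu₀, hne j hj]
      have hEx : E (Function.update x k 1) = Function.update x k 1 :=
        hEs.fixed _ fun i b h => hno ((i.1, b), i.2) fun j hj => by
          have := h j (hPS hj)
          simpa [hu₁, hne j hj] using this
      simp only [hW]
      rw [hDx, hT1 x hxR, hxk, h01, hEx, hT1 _ (hup _), Function.update_self, h11,
        Function.update_idem, ← hxk, Function.update_eq_self]
    · have hDx : D x = x := hDs.eq_self hkS hu₀k (by rw [hxk]; decide)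
      have hEx : E (Function.update x k 0) = Function.update x k 0 :=
        hEs.eq_self hkS hu₁k (by simp)
      simp only [hW]
      rw [hDx, hT1 x hxR, hxk, h11, hEx, hT1 _ (hup _), Function.update_self, h01,
        Function.update_idem, ← hxk, Function.update_eq_self]
  · have hD' : ∀ y, (¬ ∀ j ∈ R, y j = 0) → ¬ ∀ j ∈ R, D y j = 0 := fun y hy h => hy fun j hj => by
      rw [← h j hj, hDs.apply_of_notMem y (Finset.mem_sdiff.mp hj).2]
    have hE' : ∀ y, (¬ ∀ j ∈ R, y j = 0) → ¬ ∀ j ∈ R, E y j = 0 := fun y hy h => hy fun j hj => by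
      rw [← h j hj, hEs.apply_of_notMem y (Finset.mem_sdiff.mp hj).2]
    have hWy : ∀ y, (¬ ∀ j ∈ R, y j = 0) → W y = E (D y) := fun y hy => by
      simp only [hW]
      rw [hT0 _ (hD' y hy), hT0 _ (hE' _ (hD' y hy))]
    rw [hWy x hxR, hWy _ (hE' _ (hD' x hxR))]
    rcases bit_eq (x k) with hxk | hxk
    · have hEy : ∀ y, y k = 0 → E y = y := fun y hy =>
        hEs.eq_self hkS hu₁k (by rw [hy]; decide)
      have hDk : ∀ y, D y k = y k := hDs.apply_const hkS hu₀k
      rw [hEy (D x) (by rw [hDk, hxk]), hDs.apply_apply, hEy x hxk]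
    · have hDy : ∀ y, y k = 1 → D y = y := fun y hy =>
        hDs.eq_self hkS hu₀k (by rw [hy]; decide)
      have hEk : ∀ y, E y k = y k := hEs.apply_const hkS hu₁k
      rw [hDy x hxk, hDy (E x) (by rw [hEk, hxk]), hEs.apply_apply]

/-- Batches of logarithmically many exchanges cost linearly many gates, without ancillary
wires. -/
theorem batchSwap_of_pow_le {n r : ℕ} (m : ℕ) (hr : 0 < r) (hn : 2 ^ (8 * r) ≤ n) :
    BatchSwap n m (r * 2) (306 * n) := by
  classical
  intro u hu
  have e : Fin r × Bool ≃ Fin (r * 2) :=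
    (Equiv.prodCongr (Equiv.refl _) finTwoEquiv.symm).trans finProdFinEquiv
  set v : (Fin r × Bool) × Bool → Bits n := fun p => u (e p.1, p.2) with hv
  have hvi : Function.Injective v := by
    rintro ⟨i, b⟩ ⟨j, c⟩ h
    have := hu h
    simpa using this
  have h4 : 2 ^ (8 * r) = 2 ^ (4 * r) * 2 ^ (4 * r) := by rw [← pow_add]; congr 1; omega
  have h16 : 16 ≤ 2 ^ (4 * r) :=
    calc 16 = 2 ^ 4 := by norm_num
      _ ≤ _ := Nat.pow_le_pow_right (by norm_num) (by omega)
  have hr4 : r ≤ 2 ^ (4 * r) :=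
    (Nat.lt_two_pow_self).le.trans (Nat.pow_le_pow_right (by norm_num) (by omega))
  have hn4 : 2 ^ (4 * r) * 16 ≤ n := le_trans (by rw [h4]; exact Nat.mul_le_mul_left _ h16) hn
  have : Nonempty (Fin n) := ⟨⟨0, by omega⟩⟩
  -- `ρ` selects one coordinate for each distinct column of the table of the 4r strings; there are
  -- at most 2^(4r) ≤ √n of them.
  set col : Fin n → ((Fin r × Bool) × Bool → Fin 2) := fun j p => v p j with hcol
  set ρ : Fin n → Fin n := fun j => Function.invFun col (col j) with hρd
  have hcρ : ∀ j, col (ρ j) = col j := fun j => Function.invFun_eq ⟨j, rfl⟩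
  have hρ : ∀ j, ρ (ρ j) = ρ j := fun j => by
    change Function.invFun col (col (ρ j)) = _
    rw [hcρ]
  have hPcard : (Finset.univ.image ρ).card ≤ 2 ^ (4 * r) := by
    have : Finset.univ.image ρ ⊆ Finset.univ.image (Function.invFun col) := by
      intro j hj
      obtain ⟨i, -, rfl⟩ := Finset.mem_image.mp hj
      simp [hρd]
    refine (Finset.card_le_card this).trans (Finset.card_image_le.trans ?_)
    rw [Finset.card_univ]
    simp only [Fintype.card_pi, Fintype.card_fin, Finset.prod_const, Finset.card_univ,
      Fintype.card_prod, Fintype.card_bool]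
    refine Nat.pow_le_pow_right (by norm_num) (by omega)
  obtain ⟨k, hk, w, hw, hkw⟩ : ∃ k ∈ Finset.univ \ Finset.univ.image ρ,
      ∃ w ∈ Finset.univ \ Finset.univ.image ρ, k ≠ w := by
    refine Finset.one_lt_card.mp ?_
    have := Finset.le_card_sdiff (Finset.univ.image ρ) Finset.univ
    rw [Finset.card_univ, Fintype.card_fin] at this
    omega
  obtain ⟨f, hf, h1, h2⟩ := Rev.quadSwap v hvi ρ hρ (fun p j => congrFun (hcρ j) p) k w
    (by simpa using hk) (by simpa using hw) hkw
  obtain ⟨g, hg, hg1, hg2⟩ := hf.transport (Fin.castAddEmb m)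
  have happ : ∀ z : Bits n, g (Fin.append z 0) = Fin.append (f z) 0 := by
    intro z
    have hz : (Fin.append z (0 : Bits m)) ∘ Fin.castAddEmb m = z := by
      ext1 j; simp
    ext1 j
    refine Fin.addCases (fun i => ?_) (fun i => ?_) j
    · have := congrFun (hg1 (Fin.append z 0)) i
      rw [hz] at this
      simpa using this
    · rw [hg2 _ _ (by
        rintro ⟨a, ha⟩
        have := congrArg Fin.val ha
        simp at this
        omega)]
      simp
  refine ⟨g, hg.mono ?_, fun i => ?_, fun z hz => ?_⟩
  · rw [Fintype.card_fin, Fintype.card_fin]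
    have : r * (12 * (Finset.univ.image ρ).card + 24) ≤
        2 ^ (4 * r) * (12 * 2 ^ (4 * r) + 24) := by gcongr
    have h3 : 2 ^ (4 * r) * (12 * 2 ^ (4 * r) + 24) = 12 * 2 ^ (8 * r) + 24 * 2 ^ (4 * r) := by
      rw [h4]; ring
    omega
  · rw [happ]
    have := h1 (e.symm i)
    simp only [hv, Equiv.apply_symm_apply] at this
    rw [this]
  · rw [happ, h2 z fun p => hz _]

end Compressed

/-! ### Many ancillas: exchanges by table lookup -/

section Lookup

open scoped Fin.CommRing

/-- Wires of the lookup circuit: the data, one-hot encodings of the blocks, one flag for each pair,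
and one-hot encoded blocks of the output. -/
abbrev LookupWire (n N b s : ℕ) : Type :=
  Fin n ⊕ ((Fin N × (Fin b → Fin 2)) ⊕ (Fin s ⊕ (Fin N × (Fin b → Fin 2))))

/-- The state of the lookup circuit with given contents of its four registers. -/
def lookupState {n N b s : ℕ} (z : Bits n) (E : Fin N × (Fin b → Fin 2) → Fin 2) (F : Fin s → Fin 2)
    (P : Fin N × (Fin b → Fin 2) → Fin 2) : LookupWire n N b s → Fin 2 :=
  Sum.elim z (Sum.elim E (Sum.elim F P))

variable {n N b s : ℕ} (loc : Fin n → Fin N × Fin b)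

/-- The block of a bit string with a given index, for data stored at the locations `loc`. -/
noncomputable def blockOf (x : Bits n) (B : Fin N) (i : Fin b) : Fin 2 :=
  Function.extend loc x 0 (B, i)

theorem blockOf_loc (hloc : Function.Injective loc) (x : Bits n) (j : Fin n) :
    blockOf loc x (loc j).1 (loc j).2 = x j :=
  hloc.extend_apply x 0 j

/-- The one-hot encoding of the blocks of a string. -/
def oneHot (z : Bits n) (q : Fin N × (Fin b → Fin 2)) : Fin 2 :=
  if ∀ j, (loc j).1 = q.1 → z j = q.2 (loc j).2 then 1 else 0

/-- One pattern test for each block and label, borrowing a wire of the output register. Only data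
are read, so a second run erases the encoding. -/
theorem exists_encode (hloc : Function.Injective loc) : ∃ f : (LookupWire n N b s → Fin 2) → _,
    Rev (N * 2 ^ b * (10 * b + 12)) f ∧ ∀ z E F P,
      f (lookupState z E F P) = lookupState z (E + oneHot loc z) F P := by
  set S : Fin N → Finset (LookupWire n N b s) := fun B =>
    (Finset.univ.filter fun j => (loc j).1 = B).map Function.Embedding.inl with hS
  have hScard : ∀ B, (S B).card ≤ b := by
    intro B
    rw [hS, Finset.card_map]
    calc _ ≤ (Finset.univ : Finset (Fin b)).card := by
          refine Finset.card_le_card_of_injOn (fun j => (loc j).2) (by simp) ?_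
          intro i hi j hj hij
          have hi : (loc i).1 = B := by simpa using hi
          have hj : (loc j).1 = B := by simpa using hj
          exact hloc (Prod.ext (hi.trans hj.symm) hij)
      _ = b := by simp
  set t : Fin N × (Fin b → Fin 2) → LookupWire n N b s := fun q => .inr (.inl q) with ht
  set p : Fin N × (Fin b → Fin 2) → (LookupWire n N b s → Fin 2) → Fin 2 :=
    fun q x => if ∀ j ∈ S q.1, x j = (Sum.elim (fun j => q.2 (loc j).2) 0 :
      LookupWire n N b s → Fin 2) j then 1 else 0 with hp
  have H := Rev.sum Finset.univ t p (10 * b + 12) (fun q _ => by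
      refine (Rev.pattern (S q.1) _ (t q) (.inr (.inr (.inr q))) (by simp [hS, ht])
        (by simp [hS]) (by simp [ht])).mono ?_
      have := hScard q.1
      omega) fun q _ x y h => by
      have : ∀ j ∈ S q.1, x j = y j := fun j hj => h j fun r _ hr => by
        subst hr
        simp [hS, ht] at hj
      simp only [hp]
      refine if_congr (forall₂_congr fun j hj => by rw [this j hj]) rfl rfl
  refine ⟨_, H.mono (by simp), fun z E F P => ?_⟩
  ext1 w
  rcases w with j | q | i | q
  · simp [lookupState, ht]
  · simp only [lookupState, ht, Sum.elim_inr, Sum.elim_inl, Pi.add_apply, Sum.inr.injEq,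
      Sum.inl.injEq, Finset.sum_ite_eq', Finset.mem_univ, if_true, hp, oneHot]
    congr 1
    refine if_congr ?_ rfl rfl
    simp [hS]
  · simp [lookupState, ht]
  · simp [lookupState, ht]

/-- On encoded blocks, equality with a fixed string is a product of `N` bits instead of `n`. A data
wire is borrowed. -/
theorem exists_flag [NeZero n] (v : Fin s × Bool → Bits n) :
    ∃ f : (LookupWire n N b s → Fin 2) → _,
    Rev (s * 2 * (8 * N + 12)) f ∧ ∀ z E F P,
      f (lookupState z E F P) = lookupState z E (fun i =>
        F i + (∏ B, E (B, blockOf loc (v (i, false)) B) +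
          ∏ B, E (B, blockOf loc (v (i, true)) B))) P := by
  set e : Fin s × Bool → Fin N → LookupWire n N b s :=
    fun q B => .inr (.inl (B, blockOf loc (v q) B)) with he
  have hei : ∀ q, Function.Injective (e q) := fun q B B' h => by
    simp only [he, Sum.inr.injEq, Sum.inl.injEq, Prod.mk.injEq] at h
    exact h.1
  set t : Fin s × Bool → LookupWire n N b s := fun q => .inr (.inr (.inl q.1)) with ht
  set p : Fin s × Bool → (LookupWire n N b s → Fin 2) → Fin 2 :=
    fun q x => ∏ j ∈ Finset.univ.image (e q), x j with hp
  have H := Rev.sum Finset.univ t p (8 * N + 12) (fun q _ => by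
      refine (Rev.prod (Finset.univ.image (e q)) (t q) (.inl 0) (by simp [he, ht])
        (by simp [he]) (by simp [ht])).mono ?_
      rw [Finset.card_image_of_injective _ (hei q)]
      simp) fun q _ x y h => by
      refine Finset.prod_congr rfl fun j hj => h j fun r _ hr => ?_
      subst hr
      simp [he, ht] at hj
  refine ⟨_, H.mono (by simp), fun z E F P => ?_⟩
  have hp' : ∀ q, p q (lookupState z E F P) = ∏ B, E (B, blockOf loc (v q) B) := fun q => by
    rw [hp]
    simp only
    rw [Finset.prod_image (hei q).injOn]
    rfl
  ext1 w
  rcases w with j | q | i | q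
  · simp [lookupState, ht]
  · simp [lookupState, ht]
  · simp only [hp', ht, Fintype.sum_prod_type, Fintype.sum_bool, Sum.inr.injEq, Sum.inl.injEq]
    rw [Finset.sum_eq_single i (fun k _ hk => by simp [hk]) (by simp)]
    simp only [lookupState, Sum.elim_inr, Sum.elim_inl, if_true]
    ring
  · simp [lookupState, ht]

/-- Each flag is copied once per block, to the label of that block of `Δ i`, so a difference costs
`N` gates rather than up to `n`. -/
theorem exists_scatter (Δ : Fin s → Bits n) :
    ∃ f : (LookupWire n N b s → Fin 2) → _,
    Rev (N * s) f ∧ ∀ z E F P,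
      f (lookupState z E F P) = lookupState z E F (fun q =>
        P q + ∑ i, if blockOf loc (Δ i) q.1 = q.2 then F i else 0) := by
  set t : Fin N × Fin s → LookupWire n N b s :=
    fun q => .inr (.inr (.inr (q.1, blockOf loc (Δ q.2) q.1))) with ht
  have H := Rev.sum Finset.univ t (fun q x => x (.inr (.inr (.inl q.2)))) 1
    (fun q _ => .cnot _ _ (by simp [ht])) fun q _ x y h => h _ (by simp [ht])
  refine ⟨_, H.mono (by simp), fun z E F P => ?_⟩
  ext1 w
  rcases w with j | q | i | ⟨B, c⟩
  · simp [lookupState, ht]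
  · simp [lookupState, ht]
  · simp [lookupState, ht]
  · simp only [ht, Fintype.sum_prod_type, Sum.inr.injEq, Prod.mk.injEq]
    rw [Finset.sum_eq_single B (fun k _ hk => by simp [hk]) (by simp)]
    simp [lookupState]

/-- Decodes the sum of all scattered differences at once, at a cost independent of `s`: a data bit
collects the labels having a 1 at its position. -/
theorem exists_gather : ∃ f : (LookupWire n N b s → Fin 2) → _,
    Rev (n * 2 ^ b) f ∧ ∀ z E F P,
      f (lookupState z E F P) = lookupState (fun j =>
        z j + ∑ c : Fin b → Fin 2, if c (loc j).2 = 1 then P ((loc j).1, c) else 0) E F P := by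
  set t : Fin n × (Fin b → Fin 2) → LookupWire n N b s := fun q => .inl q.1 with ht
  have H := Rev.sum (Finset.univ.filter fun q : Fin n × (Fin b → Fin 2) => q.2 (loc q.1).2 = 1)
    t (fun q x => x (.inr (.inr (.inr ((loc q.1).1, q.2))))) 1
    (fun q _ => .cnot _ _ (by simp [ht])) fun q _ x y h => h _ (by simp [ht])
  refine ⟨_, H.mono ?_, fun z E F P => ?_⟩
  · rw [mul_one]
    exact (Finset.card_filter_le _ _).trans (by simp)
  ext1 w
  rcases w with j | q | i | q
  · simp only [ht, Finset.sum_filter, Fintype.sum_prod_type, Sum.inl.injEq]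
    rw [Finset.sum_eq_single j (fun k _ hk => by simp [hk]) (by simp)]
    simp [lookupState]
  · simp [lookupState, ht]
  · simp [lookupState, ht]
  · simp [lookupState, ht]

/-- Exchanging pairs of strings by table lookup on clean ancillary wires. -/
theorem batchSwap_lookup {n m N b s : ℕ} (hn : 0 < n) (hnb : n ≤ N * b)
    (hm : 2 * (N * 2 ^ b) + s ≤ m) :
    BatchSwap n m s (4 * (N * 2 ^ b * (10 * b + 12)) + 2 * (s * 2 * (8 * N + 12)) +
      2 * (N * s) + n * 2 ^ b) := by
  intro u hu
  have : NeZero n := ⟨hn.ne'⟩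
  obtain ⟨loc⟩ : Nonempty (Fin n ↪ Fin N × Fin b) :=
    Function.Embedding.nonempty_of_card_le (by simpa using hnb)
  set Δ : Fin s → Bits n := fun i => u (i, false) + u (i, true) with hΔ
  obtain ⟨f₁, hf₁, h₁⟩ := exists_encode (s := s) loc loc.injective
  obtain ⟨f₂, hf₂, h₂⟩ := exists_flag (N := N) (b := b) loc u
  obtain ⟨f₃, hf₃, h₃⟩ := exists_scatter (N := N) (b := b) loc Δ
  obtain ⟨f₄, hf₄, h₄⟩ := exists_gather (s := s) loc
  have add_self : ∀ {A : Type} (x : A → Fin 2), x + x = 0 := fun x => by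
    ext1 a; simp [bit_add_self]
  set fl : Bits n → Fin s → Fin 2 := fun z i =>
    (if z = u (i, false) then 1 else 0) + (if z = u (i, true) then 1 else 0) with hfl
  set z' : Bits n → Bits n := fun z j => z j + ∑ i, fl z i * Δ i j with hz'
  -- `oneHot` compares occupied positions only, so a block with unused positions may carry several
  -- marks. The zero-padded label of `x` is still marked exactly when `z` and `x` agree on the
  -- block.
  have hprod : ∀ z x : Bits n, ∏ B, oneHot loc z (B, blockOf loc x B) = if z = x then 1 else 0 := by
    intro z x
    split_ifs with h
    · subst h
      refine Finset.prod_eq_one fun B _ => if_pos fun j hj => ?_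
      dsimp only at hj ⊢
      rw [← hj, blockOf_loc loc loc.injective]
    · obtain ⟨j, hj⟩ := Function.ne_iff.mp h
      refine Finset.prod_eq_zero (Finset.mem_univ (loc j).1) (if_neg fun hc => hj ?_)
      exact (hc j rfl).trans (blockOf_loc loc loc.injective x j)
  have hΦ : ∀ z F, f₁ (f₂ (f₁ (lookupState z 0 F 0))) = lookupState z 0 (F + fl z) 0 := by
    intro z F
    rw [h₁, h₂, h₁, zero_add, add_self]
    congr 1
    ext1 i
    simp only [hprod, Pi.add_apply, hfl]
  have hΛ : ∀ z, f₃ (f₄ (f₃ (lookupState z 0 (fl z) 0))) = lookupState (z' z) 0 (fl z) 0 := by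
    intro z
    rw [h₃, h₄, h₃]
    congr 1
    · ext1 j
      simp only [hz', Pi.zero_apply, zero_add]
      congr 1
      simp only [← Finset.sum_filter]
      rw [Finset.sum_comm' (t' := Finset.univ) (s' := fun i =>
        Finset.univ.filter fun c => c (loc j).2 = 1 ∧ blockOf loc (Δ i) (loc j).1 = c)
        (by simp)]
      refine Finset.sum_congr rfl fun i _ => ?_
      rw [Finset.sum_const]
      rcases bit_eq (Δ i j) with h | h
      · rw [h, mul_zero, Finset.filter_eq_empty_iff.mpr]
        · simp
        · rintro c - ⟨hc, rfl⟩
          rw [blockOf_loc loc loc.injective, h] at hc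
          exact absurd hc (by decide)
      · rw [h, mul_one]
        have : (Finset.univ.filter fun c =>
            c (loc j).2 = 1 ∧ blockOf loc (Δ i) (loc j).1 = c) = {blockOf loc (Δ i) (loc j).1} := by
          ext c
          simp only [Finset.mem_filter, Finset.mem_univ, true_and, Finset.mem_singleton]
          refine ⟨fun h => h.2.symm, ?_⟩
          rintro rfl
          exact ⟨by rw [blockOf_loc loc loc.injective, h], rfl⟩
        rw [this]
        simp
    · ext1 q
      simp only [Pi.zero_apply, zero_add, bit_add_self]
  have hflu : ∀ i c k, fl (u (i, c)) k = if k = i then 1 else 0 := by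
    intro i c k
    have : ∀ c', (u (i, c) = u (k, c')) ↔ (k = i ∧ c = c') := fun c' => by
      rw [hu.eq_iff, Prod.mk.injEq]; tauto
    simp only [hfl, this]
    by_cases h : k = i <;> cases c <;> simp [h]
  have hz'u : ∀ i c, z' (u (i, c)) = u (i, !c) := by
    intro i c
    ext1 j
    have bits : ∀ a b : Fin 2, a + (a + b) = b ∧ b + (a + b) = a := by decide
    simp only [hz', hflu, ite_mul, one_mul, zero_mul, Finset.sum_ite_eq', Finset.mem_univ, if_true,
      hΔ, Pi.add_apply]
    cases c <;> simp [bits]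
  have hfl0 : ∀ z, (∀ p, z ≠ u p) → fl z = 0 := fun z hz => by
    ext1 i
    simp [hfl, hz]
  have hz'0 : ∀ z, (∀ p, z ≠ u p) → z' z = z := fun z hz => by
    ext1 j
    simp [hz', hfl0 z hz]
  have hflz' : ∀ z, fl (z' z) = fl z := by
    intro z
    by_cases hz : ∃ p, z = u p
    · obtain ⟨⟨i, c⟩, rfl⟩ := hz
      rw [hz'u]
      ext1 k
      rw [hflu, hflu]
    · push Not at hz
      rw [hz'0 z hz]
  -- Flags are computed, the flagged difference is added, and the flags are computed again. Both
  -- strings of a pair raise the same flag, so the second computation clears it.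
  set f := f₁ ∘ f₂ ∘ f₁ ∘ f₃ ∘ f₄ ∘ f₃ ∘ f₁ ∘ f₂ ∘ f₁ with hf
  have hfz : ∀ z, f (lookupState z 0 0 0) = lookupState (z' z) 0 0 0 := by
    intro z
    simp only [hf, Function.comp_apply]
    rw [hΦ, zero_add, hΛ, hΦ, hflz', add_self]
  have hrev := (((((((hf₁.comp hf₂).comp hf₁).comp hf₃).comp hf₄).comp hf₃).comp hf₁).comp
    hf₂).comp hf₁
  obtain ⟨a⟩ : Nonempty ((Fin N × (Fin b → Fin 2)) ⊕ (Fin s ⊕ (Fin N × (Fin b → Fin 2))) ↪ Fin m) :=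
    Function.Embedding.nonempty_of_card_le (by simp; omega)
  obtain ⟨g, hg, hg1, hg2⟩ := hrev.transport
    (((Function.Embedding.refl (Fin n)).sumMap a).trans finSumFinEquiv.toEmbedding)
  have happ : ∀ z : Bits n, g (Fin.append z 0) = Fin.append (z' z) 0 := by
    intro z
    have hz : (Fin.append z (0 : Bits m)) ∘
        (((Function.Embedding.refl (Fin n)).sumMap a).trans finSumFinEquiv.toEmbedding) =
        lookupState z 0 0 0 := by
      ext1 w
      rcases w with j | w
      · simp [lookupState]
      · rcases w with q | i | q <;> simp [lookupState]
    have hgz := hg1 (Fin.append z 0)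
    rw [hz] at hgz
    have hgz : _ = lookupState (z' z) 0 0 0 := hgz.trans (hfz z)
    ext1 j
    refine Fin.addCases (fun i => ?_) (fun i => ?_) j
    · have := congrFun hgz (.inl i)
      simpa [lookupState] using this
    · by_cases hi : ∃ w, a w = i
      · obtain ⟨w, rfl⟩ := hi
        have := congrFun hgz (.inr w)
        rcases w with q | i | q <;> simpa [lookupState] using this
      · rw [hg2]
        · simp
        · rintro ⟨w, hw⟩
          rcases w with k | w
          · have := congrArg Fin.val hw
            simp at this
            omega
          · simp at hw
            exact hi ⟨w, hw⟩
  refine ⟨g, hg.mono (by omega), fun i => ?_, fun z hz => ?_⟩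
  · rw [happ, hz'u]; rfl
  · rw [happ, hz'0 z hz]

end Lookup

/-! ### Gate counts in the two regimes -/

theorem le_mul_div_of_le {L κ x y : ℝ} (hL : 0 < L) (hx : 0 ≤ x) (h : L ≤ κ * y) :
    x ≤ κ * (y * x / L) := by
  rw [← mul_div_assoc, le_div_iff₀ hL]
  nlinarith [mul_le_mul_of_nonneg_left h hx]

theorem logb_add_pos {n m : ℕ} (hn : 2 ≤ n) : 0 < Real.logb 2 ((m : ℝ) + n) := by
  have h1 : (2 : ℝ) ≤ n := by exact_mod_cast hn
  have h2 : (0 : ℝ) ≤ m := Nat.cast_nonneg m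
  exact Real.logb_pos (by norm_num) (by linarith)

theorem logb_le_of_le_pow {n m k : ℕ} (hn : 0 < n) (h : m + n ≤ 2 ^ k) :
    Real.logb 2 ((m : ℝ) + n) ≤ k := by
  have h1 : (0 : ℝ) < n := by exact_mod_cast hn
  have h2 : (0 : ℝ) ≤ m := Nat.cast_nonneg m
  rw [Real.logb_le_iff_le_rpow (by norm_num) (by linarith), Real.rpow_natCast]
  exact_mod_cast h

/-- Sparse state preparation with at most polynomially many ancillary qubits. -/
theorem exists_preparation_of_le_pow {n m d : ℕ} (hn : 256 ≤ n) (hd : 0 < d) (hm : m ≤ n ^ 4)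
    (α : Fin d → ℂ) (q : Fin d → Bits n) (hq : Function.Injective q)
    (hα : ∑ i, ‖α i‖ ^ 2 = 1) :
    ∃ circ : Circuit (n + m), circ.Prepares α q ∧ (circ.length : ℝ) ≤
      210000 * ((n : ℝ) * d / Real.logb 2 ((m : ℝ) + n)) + 5226 * n := by
  -- Then 2^(8r) ≤ n ≤ 2^(16r): the lower bound admits batches of 2r pairs, and the upper one gives
  -- m + n ≤ n^5 ≤ 2^(80r), so L ≤ 80r.
  set r := Nat.log 2 n / 8 with hr
  have hlog : 8 ≤ Nat.log 2 n := Nat.le_log_of_pow_le (by norm_num) (by norm_num; omega)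
  have hr1 : 1 ≤ r := by omega
  have hlow : 2 ^ (8 * r) ≤ n :=
    (Nat.pow_le_pow_right (by norm_num) (by omega)).trans (Nat.pow_log_le_self 2 (by omega))
  have hup : n ≤ 2 ^ (16 * r) := (Nat.lt_pow_succ_log_self (by norm_num) n).le.trans
    (Nat.pow_le_pow_right (by norm_num) (by omega))
  have hrn : r ≤ n := Nat.div_le_self _ _ |>.trans (Nat.log_le_self 2 n)
  have hrn2 : 2 * r ≤ n := by
    have := Nat.log_le_self 2 n
    omega
  have hL : Real.logb 2 ((m : ℝ) + n) ≤ 80 * r := by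
    have h5 : m + n ≤ 2 ^ (80 * r) := by
      calc m + n ≤ n ^ 4 + n ^ 4 := by
            refine Nat.add_le_add hm ?_
            calc n = n ^ 1 := (pow_one n).symm
              _ ≤ n ^ 4 := Nat.pow_le_pow_right (by omega) (by norm_num)
        _ = 2 * n ^ 4 := by ring
        _ ≤ n * n ^ 4 := Nat.mul_le_mul_right _ (by omega)
        _ = n ^ 5 := by ring
        _ ≤ (2 ^ (16 * r)) ^ 5 := Nat.pow_le_pow_left hup 5
        _ = 2 ^ (80 * r) := by rw [← pow_mul]; congr 1; ring
    have := logb_le_of_le_pow (by omega) h5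
    exact_mod_cast this
  have hL0 : 0 < Real.logb 2 ((m : ℝ) + n) := logb_add_pos (by omega)
  set L := Real.logb 2 ((m : ℝ) + n)
  set B := d / (r * 2) + 1 with hB
  have hdB : d ≤ B * (r * 2) := by
    have := Nat.lt_div_mul_add (a := d) (b := r * 2) (by omega)
    rw [hB, add_mul, one_mul]
    exact this.le
  obtain ⟨circ, h1, h2⟩ := (batchSwap_of_pow_le m hr1 hlow).exists_preparation (by omega) hd hdB
    α q hq hα
  refine ⟨circ, h1, ?_⟩
  have hBs : B * (r * 2) ≤ d + n := by
    have := Nat.div_mul_le_self d (r * 2)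
    rw [hB, add_mul, one_mul]
    omega
  have hr0 : (0 : ℝ) < r := by exact_mod_cast hr1
  have hBR : (B : ℝ) ≤ d / (r * 2) + 1 := by
    have := Nat.cast_div_le (m := d) (n := r * 2) (α := ℝ)
    push_cast at this
    rw [hB]
    push_cast
    linarith
  have hnR : (0 : ℝ) ≤ n := Nat.cast_nonneg n
  have hdR : (0 : ℝ) ≤ d := Nat.cast_nonneg d
  have hrR : (r : ℝ) ≤ n := by exact_mod_cast hrn
  have e1 : (d : ℝ) ≤ 80 * (n * d / L) := le_mul_div_of_le hL0 hdR (by linarith)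
  have e2 : (d : ℝ) / (r * 2) * n ≤ 40 * (n * d / L) := by
    rw [div_mul_eq_mul_div, div_le_iff₀ (by linarith), ← mul_div_assoc, div_mul_eq_mul_div,
      le_div_iff₀ hL0]
    nlinarith [mul_le_mul_of_nonneg_left hL (mul_nonneg hdR hnR)]
  -- Here 5202 = 17·306. The final constants are 24·80 + 5202·40 = 210000 and 24 + 5202 = 5226.
  have e3 : (circ.length : ℝ) ≤ 24 * (d + n) + 5202 * (B * n) := by
    have : circ.length ≤ 24 * (d + n) + 5202 * (B * n) := by
      have : 17 * (B * (306 * n)) = 5202 * (B * n) := by ring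
      omega
    exact_mod_cast this
  have e4 : (B : ℝ) * n ≤ d / (r * 2) * n + n := by
    nlinarith [mul_le_mul_of_nonneg_right hBR hnR]
  have e5 : 0 ≤ (n : ℝ) * d / L := by positivity
  linarith

/-- Sparse state preparation with many ancillary qubits. -/
theorem exists_preparation_of_pow_lt {n m d A : ℕ} (hn : 256 ≤ n) (hd : 0 < d) (hdn : d ≤ 2 ^ n)
    (hm : n ^ 4 < m) (hA : m ≤ A * (n * d))
    (α : Fin d → ℂ) (q : Fin d → Bits n) (hq : Function.Injective q)
    (hα : ∑ i, ‖α i‖ ^ 2 = 1) :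
    ∃ circ : Circuit (n + m), circ.Prepares α q ∧ (circ.length : ℝ) ≤
      (1452 * (1 + 4 * A) * (17 * (A + 3)) : ℝ) *
        ((n : ℝ) * d / Real.logb 2 ((m : ℝ) + n)) := by
  -- With t = 2^b one has t^8 ≤ m < 256 t^8, so n^4 < m forces n < 4t². The two label registers and
  -- s = t^4 flags take at most 2t³ + t^4 ≤ t^8 ancillas.
  set b := Nat.log 2 m / 8 with hb
  have hm32 : 2 ^ 32 ≤ m := by
    calc 2 ^ 32 = 256 ^ 4 := by norm_num
      _ ≤ n ^ 4 := Nat.pow_le_pow_left hn 4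
      _ ≤ m := hm.le
  have hlog : 32 ≤ Nat.log 2 m := Nat.le_log_of_pow_le (by norm_num) hm32
  have hb4 : 4 ≤ b := by omega
  set t := 2 ^ b with ht
  have ht16 : 16 ≤ t := by
    calc 16 = 2 ^ 4 := by norm_num
      _ ≤ t := Nat.pow_le_pow_right (by norm_num) hb4
  have hbt : b ≤ t := Nat.lt_two_pow_self.le
  have hmt : t ^ 8 ≤ m := by
    rw [ht, ← pow_mul]
    exact (Nat.pow_le_pow_right (by norm_num) (by omega)).trans
      (Nat.pow_log_le_self 2 (by omega))
  have hmlt : m < 2 ^ (8 * b + 8) := (Nat.lt_pow_succ_log_self (by norm_num) m).trans_le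
    (Nat.pow_le_pow_right (by norm_num) (by omega))
  have hnt : n < 4 * t ^ 2 := by
    have : n ^ 4 < (4 * t ^ 2) ^ 4 := by
      refine hm.trans (hmlt.trans_le (le_of_eq ?_))
      rw [ht, mul_pow, ← pow_mul, ← pow_mul, show (4 : ℕ) = 2 ^ 2 by norm_num, ← pow_mul, ← pow_add]
      congr 1
      ring
    exact lt_of_pow_lt_pow_left₀ 4 (by positivity) this
  set N := n / b + 1 with hN
  have hnN : n ≤ N * b := by
    have := Nat.lt_div_mul_add (a := n) (b := b) (by omega)
    rw [hN, add_mul, one_mul]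
    exact this.le
  have hNt : N ≤ t ^ 2 := by
    have h1 : n / b ≤ n / 4 := Nat.div_le_div_left hb4 (by norm_num)
    omega
  set s := t ^ 4 with hs
  have hanc : 2 * (N * 2 ^ b) + s ≤ m := by
    refine le_trans ?_ hmt
    calc 2 * (N * t) + s ≤ 2 * (t ^ 2 * t) + t ^ 4 := by gcongr
      _ = 2 * t ^ 3 + 1 * t ^ 4 := by ring
      _ ≤ t * t ^ 3 + 1 * t ^ 4 := by gcongr; omega
      _ = 2 * t ^ 4 := by ring
      _ ≤ t ^ 4 * t ^ 4 := by
        gcongr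
        calc 2 ≤ t := by omega
          _ = t ^ 1 := (pow_one t).symm
          _ ≤ t ^ 4 := Nat.pow_le_pow_right (by omega) (by norm_num)
      _ = t ^ 8 := by ring
  have hswap := batchSwap_lookup (by omega) hnN hanc
  have hN1 : 1 ≤ N := Nat.le_add_left 1 _
  have hK : 4 * (N * 2 ^ b * (10 * b + 12)) + 2 * (s * 2 * (8 * N + 12)) +
      2 * (N * s) + n * 2 ^ b ≤ 84 * (N * s) := by
    have k1 : 4 * (N * t * (10 * b + 12)) ≤ N * s := by
      calc 4 * (N * t * (10 * b + 12)) ≤ 4 * (N * t * (11 * t)) := by gcongr; omega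
        _ = N * (44 * t ^ 2) := by ring
        _ ≤ N * (t ^ 2 * t ^ 2) := by gcongr; nlinarith
        _ = N * s := by rw [hs]; ring
    have k2 : 2 * (s * 2 * (8 * N + 12)) ≤ 80 * (N * s) := by
      calc 2 * (s * 2 * (8 * N + 12)) ≤ 2 * (s * 2 * (8 * N + 12 * N)) := by gcongr; omega
        _ = 80 * (N * s) := by ring
    have k3 : n * t ≤ N * s := by
      calc n * t ≤ N * b * t := by gcongr
        _ ≤ N * t * t := by gcongr
        _ = N * (1 * t ^ 2) := by ring
        _ ≤ N * (t ^ 2 * t ^ 2) := by gcongr; nlinarith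
        _ = N * s := by rw [hs]; ring
    rw [← ht]
    omega
  set B := d / s + 1 with hB
  have hs0 : 0 < s := by positivity
  have hdB : d ≤ B * s := by
    have := Nat.lt_div_mul_add (a := d) (b := s) hs0
    rw [hB, add_mul, one_mul]
    exact this.le
  obtain ⟨circ, h1, h2⟩ := hswap.exists_preparation (by omega) hd hdB α q hq hα
  refine ⟨circ, h1, ?_⟩
  -- The bound on m enters: a batch is not much larger than d, so rounding up the number of batches
  -- costs a constant factor.
  have hsd : s ≤ 4 * A * d := by
    have : t ^ 2 * t ^ 6 ≤ t ^ 2 * (4 * A * d) := by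
      calc t ^ 2 * t ^ 6 = t ^ 8 := by ring
        _ ≤ A * (n * d) := hmt.trans hA
        _ ≤ A * (4 * t ^ 2 * d) := by gcongr
        _ = t ^ 2 * (4 * A * d) := by ring
    have := Nat.le_of_mul_le_mul_left this (by positivity)
    exact (Nat.pow_le_pow_right (by omega) (by norm_num)).trans this
  have hBs : B * s ≤ (1 + 4 * A) * d := by
    have := Nat.div_mul_le_self d s
    have e : (1 + 4 * A) * d = d + 4 * A * d := by ring
    rw [hB, add_mul, one_mul, e]
    omega
  -- 1452 = 24 + 17·84.
  have hlen : circ.length ≤ 1452 * (1 + 4 * A) * (d * N) := by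
    calc circ.length ≤ 24 * (B * s) + 17 * (B * (84 * (N * s))) := by
          refine h2.trans ?_
          gcongr
      _ = (24 * 1 + 1428 * N) * (B * s) := by ring
      _ ≤ (24 * N + 1428 * N) * (B * s) := by gcongr
      _ ≤ (24 * N + 1428 * N) * ((1 + 4 * A) * d) := by gcongr
      _ = 1452 * (1 + 4 * A) * (d * N) := by ring
  have hL : Real.logb 2 ((m : ℝ) + n) ≤ 17 * b := by
    have : m + n ≤ 2 ^ (17 * b) := by
      have hnm : n ≤ m := by
        refine le_trans ?_ hm.le
        calc n = n ^ 1 := (pow_one n).symm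
          _ ≤ n ^ 4 := Nat.pow_le_pow_right (by omega) (by norm_num)
      calc m + n ≤ 2 ^ (8 * b + 8) + 2 ^ (8 * b + 8) := by omega
        _ = 2 ^ (8 * b + 9) := by ring
        _ ≤ 2 ^ (17 * b) := Nat.pow_le_pow_right (by norm_num) (by omega)
    have := logb_le_of_le_pow (by omega) this
    exact_mod_cast this
  -- Together with d ≤ 2^n the bound on m gives b = O(n), which absorbs the rounding in N = n/b + 1.
  have hbA : b ≤ (A + 2) * n := by
    have h8 : 2 ^ (8 * b) ≤ 2 ^ (A + (n + n)) := by
      calc 2 ^ (8 * b) = t ^ 8 := by rw [ht, ← pow_mul, mul_comm]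
        _ ≤ A * (n * d) := hmt.trans hA
        _ ≤ 2 ^ A * (2 ^ n * 2 ^ n) := by
          gcongr
          · exact Nat.lt_two_pow_self.le
          · exact Nat.lt_two_pow_self.le
        _ = 2 ^ (A + (n + n)) := by rw [pow_add, pow_add]
    have := (Nat.pow_le_pow_iff_right (by norm_num : 1 < 2)).mp h8
    have hAn : A * 1 ≤ A * n := Nat.mul_le_mul_left _ (by omega)
    rw [add_mul]
    omega
  have hL0 : 0 < Real.logb 2 ((m : ℝ) + n) := logb_add_pos (by omega)
  set L := Real.logb 2 ((m : ℝ) + n)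
  have hb0 : (0 : ℝ) < b := by exact_mod_cast (show 0 < b by omega)
  have hdR : (0 : ℝ) ≤ d := Nat.cast_nonneg d
  have hnR : (0 : ℝ) ≤ n := Nat.cast_nonneg n
  have hAR : (0 : ℝ) ≤ A := Nat.cast_nonneg A
  have hNR : (N : ℝ) ≤ n / b + 1 := by
    have := Nat.cast_div_le (m := n) (n := b) (α := ℝ)
    rw [hN]
    push_cast
    linarith
  have hbAR : (b : ℝ) ≤ (A + 2) * n := by exact_mod_cast hbA
  have e1 : (d : ℝ) ≤ 17 * (A + 2) * (n * d / L) :=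
    le_mul_div_of_le hL0 hdR (by nlinarith)
  have e2 : (d : ℝ) * (n / b) ≤ 17 * (n * d / L) := by
    rw [← mul_div_assoc, div_le_iff₀ hb0, ← mul_div_assoc, div_mul_eq_mul_div, le_div_iff₀ hL0]
    nlinarith [mul_le_mul_of_nonneg_left hL (mul_nonneg hdR hnR)]
  have e3 : (d : ℝ) * N ≤ 17 * (A + 3) * (n * d / L) := by
    calc (d : ℝ) * N ≤ d * (n / b + 1) := by gcongr
      _ = d * (n / b) + d := by ring
      _ ≤ 17 * (n * d / L) + 17 * (A + 2) * (n * d / L) := add_le_add e2 e1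
      _ = 17 * (A + 3) * (n * d / L) := by ring
  calc (circ.length : ℝ) ≤ 1452 * (1 + 4 * A) * (d * N) := by exact_mod_cast hlen
    _ ≤ 1452 * (1 + 4 * A) * (17 * (A + 3) * (n * d / L)) := by gcongr
    _ = _ := by ring

end QCircuit

theorem theorem2 :
    ∀ c : ℝ, ∃ C : ℝ, 0 < C ∧
      ∀ n d m : ℕ, 0 < n → 0 < d → d ≤ 2 ^ n →
        (m : ℝ) ≤ c * ((n : ℝ) * d / Real.logb 2 ((n : ℝ) * d) + n) →
        ∀ (α : Fin d → ℂ) (q : Fin d → QCircuit.Bits n),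
          Function.Injective q → ∑ i, ‖α i‖ ^ 2 = 1 →
          ∃ circ : QCircuit.Circuit (n + m),
            QCircuit.Circuit.Prepares circ α q ∧
            (QCircuit.Circuit.size circ : ℝ) ≤
              C * ((n : ℝ) * d / Real.logb 2 ((m : ℝ) + n) + n) := by
  intro c
  obtain ⟨a, ha⟩ := exists_nat_ge |c|
  -- The factor 2 appears because, for n ≥ 256, both nd/log₂(nd) and n are at most nd.
  set A := 2 * a with hA
  set C₁ : ℝ := 1452 * (1 + 4 * A) * (17 * (A + 3)) with hC₁
  have hC₁0 : 0 ≤ C₁ := by positivity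
  refine ⟨6 * 2 ^ 256 + 210000 + C₁, by positivity, fun n d m hn hd hdn hm α q hq hα => ?_⟩
  have hn1 : (1 : ℝ) ≤ n := by exact_mod_cast hn
  have hd1 : (1 : ℝ) ≤ d := by exact_mod_cast hd
  have hX : 0 ≤ (n : ℝ) * d / Real.logb 2 ((m : ℝ) + n) := by
    refine div_nonneg (by positivity) (Real.logb_nonneg (by norm_num) ?_)
    have : (0 : ℝ) ≤ m := Nat.cast_nonneg m
    linarith
  set X := (n : ℝ) * d / Real.logb 2 ((m : ℝ) + n)
  have hbig : (0 : ℝ) ≤ 2 ^ 256 := by positivity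
  -- The constant is made opaque so that the arithmetic tactics do not evaluate it.
  generalize hG : (2 : ℝ) ^ 256 = G at *
  rcases Nat.lt_or_ge n 256 with hn256 | hn256
  -- For n < 256 the dense cost is at most 6·2^256, charged to the summand n ≥ 1.
  · obtain ⟨circ, h1, h2⟩ := QCircuit.exists_preparation_of_support (m := m) hn n le_rfl α q hq hα
      fun i j hj => absurd j.isLt (by omega)
    refine ⟨circ, h2, ?_⟩
    have h3 : ((circ.length : ℕ) : ℝ) ≤ 6 * 2 ^ 256 := by
      calc ((circ.length : ℕ) : ℝ) ≤ 6 * 2 ^ n := by exact_mod_cast h1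
        _ ≤ 6 * 2 ^ 256 := by
          gcongr
          norm_num
    rw [hG] at h3
    change ((circ.length : ℕ) : ℝ) ≤ _
    have : 0 ≤ (6 * G + 210000 + C₁) * X := by positivity
    nlinarith
  have hmA : m ≤ A * (n * d) := by
    have hnd : (n : ℝ) * d / Real.logb 2 ((n : ℝ) * d) ≤ n * d := by
      refine div_le_self (by positivity) ?_
      rw [Real.le_logb_iff_rpow_le (by norm_num) (by positivity), Real.rpow_one]
      have : (256 : ℝ) ≤ n := by exact_mod_cast hn256
      nlinarith
    have hnd0 : 0 ≤ (n : ℝ) * d / Real.logb 2 ((n : ℝ) * d) :=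
      div_nonneg (by positivity) (Real.logb_nonneg (by norm_num) (by nlinarith))
    have : (m : ℝ) ≤ A * (n * d) := by
      calc (m : ℝ) ≤ c * ((n : ℝ) * d / Real.logb 2 ((n : ℝ) * d) + n) := hm
        _ ≤ a * ((n : ℝ) * d / Real.logb 2 ((n : ℝ) * d) + n) := by
          gcongr
          exact (le_abs_self c).trans ha
        _ ≤ a * (n * d + n * d) := by
          gcongr
          nlinarith
        _ = A * (n * d) := by rw [hA]; push_cast; ring
    exact_mod_cast this
  rcases Nat.lt_or_ge (n ^ 4) m with hnm | hnm
  · obtain ⟨circ, h1, h2⟩ := QCircuit.exists_preparation_of_pow_lt hn256 hd hdn hnm hmA α q hq hα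
    refine ⟨circ, h1, h2.trans ?_⟩
    have e1 : 0 ≤ (6 * G + 210000) * X := by positivity
    have e2 : 0 ≤ (6 * G + 210000 + C₁) * n := by positivity
    change C₁ * X ≤ _
    linarith
  · obtain ⟨circ, h1, h2⟩ := QCircuit.exists_preparation_of_le_pow hn256 hd hnm α q hq hα
    refine ⟨circ, h1, h2.trans ?_⟩
    have e1 : 0 ≤ (6 * G + C₁) * X := by positivity
    have e2 : 0 ≤ (6 * G + C₁) * n := by positivity
    change 210000 * X + 5226 * n ≤ _
    nlinarith
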